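/- Let $L$ be a split semisimple real Lie algebra with splitting Cartan subalgebra $H_0$, root system $\Phi$, simple roots $\Delta$, coroots $\alpha^\vee$, and reflections $w_\alpha$. Let $(e_\alpha)_{\alpha\in\Phi}$ be a Chevalley system: root vectors with $[e_\alpha,e_{-\alpha}]=\alpha^\vee$ such that $e_\alpha\mapsto -e_{-\alpha}$ extends to an automorphism of $L$. Write $[e_\alpha,e_\beta]=N_{\alpha\beta}e_{\alpha+\beta}$ when $\alpha+\beta\in\Phi$. Let $G$ be the real split simply connected Chevalley group of $L$, generated by $\chi_\alpha(x)=\exp(xe_\alpha)$ ($\alpha\in\Phi$, $x\in\mathbb R$). Put $\widetilde w_\alpha(t)=\chi_\alpha(t)\chi_{-\alpha}(-t^{-1})\chi_\alpha(t)$, $\widetilde w_\alpha=\widetilde w_\alpha(1)$, $h_\alpha(t)=\widetilde w_\alpha^{-1}\widetilde w_\alpha(t)$. Let $K$ be the subgroup of $G$ fixed by the Cartan involution $\theta$ with $\theta(\chi_\alpha(x))=\chi_{-\alpha}(-x)$. Let $H^+=\langle h_\alpha(t)\mid\alpha\in\Delta,\ t>0\rangle$ and $U=\langle\chi_\alpha(x)\mid\alpha\in\Phi^+,\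 x\in\mathbb R\rangle$. Enumerate $\Phi^+=\{\alpha_1,\dots,\alpha_N\}$ so that $\operatorname{ht}(\alpha_r)<\operatorname{ht}(\alpha_s)$ implies $r<s$, with simple roots $\alpha_1,\dots,\alpha_n$. Write $\chi_r,h_i,\widetilde w_i,w_i$ for $\chi_{\alpha_r},h_{\alpha_i},\widetilde w_{\alpha_i},w_{\alpha_i}$. Let $C_{ij}=\langle\alpha_i,\alpha_j^\vee\rangle$. Structure constants. Put $M_{\alpha\beta k}=\frac1{k!}\prod_{l=0}^{k-1}N_{\alpha,\,l\alpha+\beta}$ and, whenever $a\alpha+b\beta\in\Phi$ with $a,b>0$ and $\alpha,\beta$ linearly independent, $$C_{1b\alpha\beta}=(-1)^bM_{\beta\alpha b},\quad C_{a1\alpha\beta}=(-1)^{a+1}M_{\alpha\beta a},\quad C_{32\alpha\beta}=-\tfrac23M_{\alpha+\beta,\alpha,2},\quad C_{23\alpha\beta}=-\tfrac13M_{\alpha+\beta,\beta,2};$$ these are the constants of the relation $\chi_\beta(-y)\chi_\alpha(x)\chi_\beta(y)=\chi_\alpha(x)\prod_{a,b>0}\chi_{a\alpha+b\beta}(C_{ab\alpha\beta}x^ay^b)$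 (product by increasing $a+b$). Put $\eta_{\alpha,\pm\alpha}=-1$ and, for $\beta\ne\pm\alpha$ with $\alpha$-string $\beta-p\alpha,\dots,\beta+q\alpha$, $$\eta_{\alpha\beta}=(-1)^q\prod_{l=0}^{p-1}\varepsilon_l\prod_{l=0}^{q-1}\varepsilon_l,\qquad \varepsilon_l=\operatorname{sgn}N_{\alpha,\,\beta+(l-p)\alpha};$$ these are the signs of the relation $\widetilde w_\alpha^{-1}\chi_\beta(x)\widetilde w_\alpha=\chi_{w_\alpha\beta}(\eta_{\alpha\beta}x)$. Let $h=\prod_{j=1}^nh_j(t_j)$ with all $t_j>0$, let $u=\prod_{r=1}^N\chi_r(x_r)$ with $x_r\in\mathbb R$ (in this order), and let $1\le i\le n$. Put $c_i=\prod_{j=1}^nt_j^{-C_{ij}}$, $r_i=\sqrt{(c_ix_i)^2+1}$, and $$\kappa=\kappa_i(c_ix_i),\qquad \kappa_i(x)=\chi_i(-x)\,h_i\!\left(-1/\sqrt{x^2+1}\right)\widetilde w_i\,\chi_i(-x).$$ Then $\kappa\in K$ and $$\kappa\,hu\,\widetilde w_i=h^{(i)}u^{(i)},\qquad h^{(i)}=h_i(c_i/r_i)\,h\in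 H^+,$$ $$u^{(i)}=\chi_i\!\left(-(c_i/r_i)^2x_i\right)\cdot\prod_{r=1}^{i-1}\chi_{w_i\alpha_r}(\eta_{\alpha_i\alpha_r}x_r)\,\tilde\chi_{ri}\cdot\prod_{r=i+1}^{N}\chi_{w_i\alpha_r}(\eta_{\alpha_i\alpha_r}x_r)\in U,$$ $$\tilde\chi_{ri}=\prod_{a,b>0,\ a\alpha_r+b\alpha_i\in\Phi}\chi_{w_i(a\alpha_r+b\alpha_i)}\!\left(\eta_{\alpha_i,\,a\alpha_r+b\alpha_i}\,C_{ab\alpha_r\alpha_i}\,x_r^ax_i^b\right),$$ the last product being taken in the order of increasing $a+b$. Consequently $K\,hu\cdot\widetilde w_i=K\,h^{(i)}u^{(i)}$ in $K\backslash G$. -/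

import Mathlib

open LieAlgebra LieAlgebra.IsKilling

attribute [local instance] LieRing.ofAssociativeRing

noncomputable section

namespace ChevalleyIwasawa

/-! ### Roots -/

section Roots

variable {L : Type*} [LieRing L] [LieAlgebra ℝ L] [FiniteDimensional ℝ L] [IsKilling ℝ L]
  {H : LieSubalgebra ℝ L} [H.IsCartanSubalgebra] [LieModule.IsTriangularizable ℝ H L]

/-- The root `-α`. -/
def negRoot (α : H.root) : H.root :=
  ⟨-α.1, by
    have h := H.isNonZero_coe_root α
    simpa using h.neg⟩

/-- The root `w_α β`, where `w_α` is the reflection in `α`. -/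
def reflRoot (α β : H.root) : H.root := (rootSystem H).reflectionPerm α β

/-- The linear combination `a α + b β` is a root. -/
def IsRootComb (a b : ℤ) (α β : H.root) : Prop :=
  ∃ γ : H.root, (rootSystem H).root γ = a • (rootSystem H).root α + b • (rootSystem H).root β

open Classical in
/-- The root `a α + b β`, when this linear combination is a root (and `β` otherwise; this value is
never relevant). -/
def combRoot (a b : ℤ) (α β : H.root) : H.root :=
  if h : IsRootComb a b α β then h.choose else β

/-- An enumeration `α_1, …, α_N` of the positive roots with respect to a base `b` that is
compatible with the height, in which the simple roots are `α_1, …, α_n` (indices start at `0`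
below). -/
structure PositiveRootOrdering (b : (rootSystem H).Base) where
  /-- the number of simple roots -/
  n : ℕ
  /-- the number of positive roots -/
  N : ℕ
  n_le_N : n ≤ N
  root : Fin N → H.root
  root_injective : Function.Injective root
  isPos_iff : ∀ α : H.root, b.IsPos α ↔ α ∈ Set.range root
  lt_of_height_lt : ∀ r s, b.height (root r) < b.height (root s) → r < s
  mem_support_iff : ∀ r, root r ∈ b.support ↔ (r : ℕ) < n

namespace PositiveRootOrdering

variable {b : (rootSystem H).Base} (ord : PositiveRootOrdering b)

/-- The position of the `i`-th simple root in the list of all positive roots. -/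
def pos (i : Fin ord.n) : Fin ord.N := Fin.castLE ord.n_le_N i

/-- The `i`-th simple root. -/
def simple (i : Fin ord.n) : b.support :=
  ⟨ord.root (ord.pos i), (ord.mem_support_iff _).2 i.2⟩

/-- The entry `C_ij = ⟨α_i, α_j^∨⟩` of the Cartan matrix. -/
def cartan (i j : Fin ord.n) : ℤ := b.cartanMatrix (ord.simple i) (ord.simple j)

end PositiveRootOrdering

end Roots

/-! ### Chevalley systems and their structure constants -/

section System

variable {L : Type*} [LieRing L] [LieAlgebra ℝ L] [FiniteDimensional ℝ L] [IsKilling ℝ L]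

/-- A Chevalley system of the split semisimple Lie algebra `L` with splitting Cartan subalgebra
`H`: root vectors `e_α` with `[e_α, e_{-α}] = α^∨`, for which `e_α ↦ -e_{-α}` is induced by an
automorphism of `L` (the Chevalley involution). Together with the simple coroots, the `e_α` form a
Chevalley basis of `L`. -/
structure ChevalleySystem (H : LieSubalgebra ℝ L) [H.IsCartanSubalgebra]
    [LieModule.IsTriangularizable ℝ H L] where
  e : H.root → L
  e_mem : ∀ α : H.root, e α ∈ rootSpace H α.1
  lie_e_neg : ∀ α : H.root, ⁅e α, e (negRoot α)⁆ = (coroot α.1 : L)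
  /-- the Chevalley involution -/
  invol : L ≃ₗ⁅ℝ⁆ L
  invol_e : ∀ α : H.root, invol (e α) = -e (negRoot α)

variable {H : LieSubalgebra ℝ L} [H.IsCartanSubalgebra] [LieModule.IsTriangularizable ℝ H L]
  (E : ChevalleySystem H)

namespace ChevalleySystem

open Classical in
/-- The structure constant `N_{αβ}` with `[e_α, e_β] = N_{αβ} e_{α+β}` if `α + β` is a root, and `0`
otherwise. -/
def N (α β : H.root) : ℝ :=
  if h : IsRootComb 1 1 α β ∧ ∃ c : ℝ, ⁅E.e α, E.e β⁆ = c • E.e (combRoot 1 1 α β) then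
    h.2.choose
  else 0

/-- `M_{αβk} = (1 / k!) N_{α,β} N_{α,α+β} ⋯ N_{α,(k-1)α+β}`. -/
def M (α β : H.root) (k : ℕ) : ℝ :=
  ((k.factorial : ℝ))⁻¹ * ∏ l ∈ Finset.range k, E.N α (combRoot l 1 α β)

/-- The constants `C_{abαβ}` of the commutator relation
`χ_β(-y) χ_α(x) χ_β(y) = χ_α(x) ∏ χ_{aα+bβ}(C_{abαβ} x^a y^b)`, in terms of the structure constants
of the Lie algebra. -/
def C (a b : ℕ) (α β : H.root) : ℝ :=
  if a = 1 then (-1) ^ b * E.M β α b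
  else if b = 1 then (-1) ^ (a + 1) * E.M α β a
  else if a = 3 ∧ b = 2 then -(2 / 3) * E.M (combRoot 1 1 α β) α 2
  else if a = 2 ∧ b = 3 then -(1 / 3) * E.M (combRoot 1 1 α β) β 2
  else 0

/-- The sign of `N_{α, β+lα}`. -/
def chainSign (α β : H.root) (l : ℤ) : ℝ := (SignType.sign (E.N α (combRoot l 1 α β)) : ℝ)

open Classical in
/-- The signs `η_{αβ}` of the relation `w_α⁻¹ χ_β(x) w_α = χ_{w_α β}(η_{αβ} x)`, in terms of the
structure constants of the Lie algebra: if `β - pα, …, β, …, β + qα` is the `α`-string through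
`β ≠ ±α` and `ε_l` is the sign of `N_{α, β+(l-p)α}`, then
`η_{αβ} = (-1)^q (ε_0 ⋯ ε_{p-1}) (ε_0 ⋯ ε_{q-1})`. -/
def eta (α β : H.root) : ℝ :=
  if β = α ∨ β = negRoot α then -1
  else
    (-1) ^ (rootSystem H).chainTopCoeff α β *
      (∏ l ∈ Finset.range ((rootSystem H).chainBotCoeff α β),
        E.chainSign α β ((l : ℤ) - (rootSystem H).chainBotCoeff α β)) *
      ∏ l ∈ Finset.range ((rootSystem H).chainTopCoeff α β),
        E.chainSign α β ((l : ℤ) - (rootSystem H).chainBotCoeff α β)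

end ChevalleySystem

end System

/-! ### The simply connected Chevalley group -/

section Group

/-- The matrix exponential, as an invertible matrix. -/
def expGL {m : ℕ} (A : Matrix (Fin m) (Fin m) ℝ) : GL (Fin m) ℝ where
  val := NormedSpace.exp A
  inv := NormedSpace.exp (-A)
  val_inv := by
    rw [← Matrix.exp_add_of_commute _ _ (Commute.refl A).neg_right]
    simp
  inv_val := by
    rw [← Matrix.exp_add_of_commute _ _ (Commute.refl A).neg_left]
    simp

/-- The finite-dimensional (matrix) representations of `L`. -/
def MatRep (L : Type*) [LieRing L] [LieAlgebra ℝ L] : Type _ :=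
  Σ m : ℕ, L →ₗ⁅ℝ⁆ Matrix (Fin m) (Fin m) ℝ

/-- The product of the general linear groups of all finite-dimensional representations of `L`. -/
abbrev AllGL (L : Type*) [LieRing L] [LieAlgebra ℝ L] : Type _ :=
  ∀ ρ : MatRep L, GL (Fin ρ.1) ℝ

/-- The exponential of `X` in all finite-dimensional representations simultaneously. -/
def expAll {L : Type*} [LieRing L] [LieAlgebra ℝ L] (X : L) : AllGL L := fun ρ => expGL (ρ.2 X)

variable {L : Type*} [LieRing L] [LieAlgebra ℝ L] [FiniteDimensional ℝ L] [IsKilling ℝ L]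
  {H : LieSubalgebra ℝ L} [H.IsCartanSubalgebra] [LieModule.IsTriangularizable ℝ H L]
  (E : ChevalleySystem H)

namespace ChevalleySystem

/-- The group `G` of real points of the split simply connected semisimple group with Lie algebra
`L`, as the Chevalley group generated by the `exp (x e_α)`. It acts on every finite-dimensional
representation of `L`, so that all weights occur; this is what makes it the simply connected
form. (A faithful representation whose weights span the weight lattice already determines the
others, so `G` is isomorphic to the Chevalley group built from any such representation.) -/
def G : Subgroup (AllGL L) :=
  Subgroup.closure {g | ∃ (α : H.root) (x : ℝ), g = expAll (x • E.e α)}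

/-- The Chevalley generator `χ_α(x) = exp (x e_α)`. -/
def χ (α : H.root) (x : ℝ) : E.G :=
  ⟨expAll (x • E.e α), Subgroup.subset_closure ⟨α, x, rfl⟩⟩

/-- `w_α(t) = χ_α(t) χ_{-α}(-t⁻¹) χ_α(t)`. -/
def wt (α : H.root) (t : ℝ) : E.G := E.χ α t * E.χ (negRoot α) (-t⁻¹) * E.χ α t

/-- `w_α = w_α(1)`. -/
def w (α : H.root) : E.G := E.wt α 1

/-- `h_α(t) = w_α⁻¹ w_α(t)`. -/
def h (α : H.root) (t : ℝ) : E.G := (E.w α)⁻¹ * E.wt α t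

/-- The subgroup `U` generated by the root subgroups of the positive roots. -/
def U (b : (rootSystem H).Base) : Subgroup E.G :=
  Subgroup.closure {g | ∃ (α : H.root) (x : ℝ), b.IsPos α ∧ g = E.χ α x}

/-- The subgroup `H⁺` generated by the `h_α(t)` with `α` simple and `t > 0`. -/
def Hplus (b : (rootSystem H).Base) : Subgroup E.G :=
  Subgroup.closure {g | ∃ (α : H.root) (t : ℝ), α ∈ b.support ∧ 0 < t ∧ g = E.h α t}

/-- Precomposition of the representations with the Chevalley involution. -/
def thetaAll : AllGL L →* AllGL L where
  toFun g ρ := g ⟨ρ.1, ρ.2.comp (E.invol : L →ₗ⁅ℝ⁆ L)⟩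
  map_one' := rfl
  map_mul' _ _ := rfl

theorem thetaAll_expAll (α : H.root) (x : ℝ) :
    E.thetaAll (expAll (x • E.e α)) = expAll ((-x) • E.e (negRoot α)) := by
  funext ρ
  change expGL (ρ.2 (E.invol (x • E.e α))) = expGL (ρ.2 ((-x) • E.e (negRoot α)))
  rw [map_smul, E.invol_e, smul_neg, neg_smul]

theorem thetaAll_mem (g : E.G) : E.thetaAll g ∈ E.G := by
  have key : E.G ≤ E.G.comap E.thetaAll := by
    refine (Subgroup.closure_le _).2 ?_
    rintro _ ⟨α, x, rfl⟩
    change E.thetaAll _ ∈ E.G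
    rw [E.thetaAll_expAll]
    exact Subgroup.subset_closure ⟨_, _, rfl⟩
  exact key g.2

/-- The Cartan involution `θ` of `G`. -/
def θ : E.G →* E.G := (E.thetaAll.comp E.G.subtype).codRestrict E.G E.thetaAll_mem

/-- `θ` is the Cartan involution with `θ(χ_α(x)) = χ_{-α}(-x)`. -/
theorem θ_χ (α : H.root) (x : ℝ) : E.θ (E.χ α x) = E.χ (negRoot α) (-x) :=
  Subtype.ext (E.thetaAll_expAll α x)

/-- The maximal compact subgroup `K`: the elements of `G` that are fixed by `θ`. -/
def K : Subgroup E.G := E.θ.eqLocus (MonoidHom.id E.G)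

/-- `κ_α(x) = χ_α(-x) h_α(-1 / √(x² + 1)) w_α χ_α(-x)`. -/
def κ (α : H.root) (x : ℝ) : E.G :=
  E.χ α (-x) * E.h α (-1 / √(x ^ 2 + 1)) * E.w α * E.χ α (-x)

/-- The coset space `K \ G`. -/
abbrev CosetSpace : Type _ := Quotient (QuotientGroup.rightRel E.K)

/-- The coset `K g`. -/
def coset (g : E.G) : E.CosetSpace := Quotient.mk _ g

open Classical in
/-- The product of the factors `χ_{w_α(aβ+bα)}(η_{α,aβ+bα} C_{abβα} x^a y^b)` over all `a, b > 0` for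
which `aβ + bα` is a root, in the order of increasing `a + b`. The pairs `(a, b)` in the list
are the only ones that can occur for linearly independent roots. -/
def χtilde (β α : H.root) (x y : ℝ) : E.G :=
  (([(1, 1), (1, 2), (2, 1), (1, 3), (3, 1), (2, 3), (3, 2)] : List (ℕ × ℕ)).map fun ab =>
    if IsRootComb ab.1 ab.2 β α then
      E.χ (reflRoot α (combRoot ab.1 ab.2 β α))
        (E.eta α (combRoot ab.1 ab.2 β α) * E.C ab.1 ab.2 β α * x ^ ab.1 * y ^ ab.2)
    else 1).prod

variable {b : (rootSystem H).Base} (ord : PositiveRootOrdering b)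

/-- `h = h_1(t_1) ⋯ h_n(t_n)`. -/
def hProd (t : Fin ord.n → ℝ) : E.G :=
  (List.ofFn fun j => E.h (ord.simple j) (t j)).prod

/-- `u = χ_1(x_1) ⋯ χ_N(x_N)`. -/
def uProd (x : Fin ord.N → ℝ) : E.G :=
  (List.ofFn fun r => E.χ (ord.root r) (x r)).prod

/-- `u⁽ⁱ⁾`, the product of `χ_i(-(c/ρ)² x_i)`, of
`χ_{w_i α_r}(η_{α_i α_r} x_r) χtilde_{ri}` for `r = 1, …, i - 1`, and of
`χ_{w_i α_r}(η_{α_i α_r} x_r)` for `r = i + 1, …, N`, in this order. -/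
def uNew (i : Fin ord.n) (c ρ : ℝ) (x : Fin ord.N → ℝ) : E.G :=
  E.χ (ord.simple i) (-(c / ρ) ^ 2 * x (ord.pos i)) *
    (((List.finRange ord.N).filter (fun r => r < ord.pos i)).map fun r =>
      E.χ (reflRoot (ord.simple i) (ord.root r)) (E.eta (ord.simple i) (ord.root r) * x r) *
        E.χtilde (ord.root r) (ord.simple i) (x r) (x (ord.pos i))).prod *
    (((List.finRange ord.N).filter (fun r => ord.pos i < r)).map fun r =>
      E.χ (reflRoot (ord.simple i) (ord.root r))
        (E.eta (ord.simple i) (ord.root r) * x r)).prod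

end ChevalleySystem

end Group

end ChevalleyIwasawa

end

noncomputable section

namespace ChevalleyIwasawa

/-! ### Exponentials in Banach algebras -/

section Banach

open NormedSpace Finset

variable {𝔸 : Type*} [NormedRing 𝔸] [NormedAlgebra ℝ 𝔸] [CompleteSpace 𝔸]

theorem exp_smul_mul_exp_neg_smul (A : 𝔸) (t : ℝ) : exp (t • A) * exp (-(t • A)) = 1 := by
  let _ : NormedAlgebra ℚ 𝔸 := NormedAlgebra.restrictScalars ℚ ℝ 𝔸
  rw [← exp_add_of_commute (Commute.refl _).neg_right, add_neg_cancel, exp_zero]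

theorem exp_neg_smul_mul_exp_smul (A : 𝔸) (t : ℝ) : exp (-(t • A)) * exp (t • A) = 1 := by
  let _ : NormedAlgebra ℚ 𝔸 := NormedAlgebra.restrictScalars ℚ ℝ 𝔸
  rw [← exp_add_of_commute (Commute.refl _).neg_left, neg_add_cancel, exp_zero]

omit [CompleteSpace 𝔸] in
theorem eq_of_hasDerivAt_eq {f g f' : ℝ → 𝔸} (hf : ∀ t, HasDerivAt f (f' t) t)
    (hg : ∀ t, HasDerivAt g (f' t) t) (h0 : f 0 = g 0) (t : ℝ) : f t = g t := by
  have h := is_const_of_deriv_eq_zero (f := f - g) (𝕜 := ℝ)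
    (fun t => ((hf t).sub (hg t)).differentiableAt)
    (fun t => by rw [((hf t).sub (hg t)).deriv, sub_self]) t 0
  simpa [sub_eq_zero, h0] using h

/-- Both sides equal `B` at `t = 0`, and their derivatives are the two sides of the same identity
for `⁅A, B⁆`, which already dies under the `n`-th power of `ad A`. Hence induction on `n`. -/
theorem exp_smul_conj (A : 𝔸) (n : ℕ) : ∀ B : 𝔸, ((ad ℝ 𝔸 A) ^ n) B = 0 → ∀ t : ℝ,
    exp (t • A) * B * exp (-(t • A)) =
      ∑ k ∈ range n, ((k.factorial : ℝ)⁻¹ * t ^ k) • ((ad ℝ 𝔸 A) ^ k) B := by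
  let _ : NormedAlgebra ℚ 𝔸 := NormedAlgebra.restrictScalars ℚ ℝ 𝔸
  induction n with
  | zero => intro B hB t; simp_all
  | succ n ih =>
    intro B hB t
    have ih' := ih ⁅A, B⁆ (by rw [pow_succ] at hB; simpa using hB)
    refine eq_of_hasDerivAt_eq (f := fun t => exp (t • A) * B * exp (-(t • A)))
      (f' := fun t => exp (t • A) * ⁅A, B⁆ * exp (-(t • A)))
      (g := fun t => ∑ k ∈ range (n + 1), ((k.factorial : ℝ)⁻¹ * t ^ k) • ((ad ℝ 𝔸 A) ^ k) B)
      ?_ ?_ ?_ t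
    · intro t
      have h1 := hasDerivAt_exp_smul_const (𝕂 := ℝ) A t
      have h2 := hasDerivAt_exp_smul_const' (𝕂 := ℝ) (-A) t
      have := (h1.mul_const B).mul h2
      simp only [smul_neg] at this
      refine this.congr_deriv ?_
      rw [LieRing.of_associative_ring_bracket]
      noncomm_ring
    · intro t
      simp only [ih']
      have : ∀ k ∈ range (n + 1), HasDerivAt
          (fun t : ℝ => ((k.factorial : ℝ)⁻¹ * t ^ k) • ((ad ℝ 𝔸 A) ^ k) B)
          (((k.factorial : ℝ)⁻¹ * (k * t ^ (k - 1))) • ((ad ℝ 𝔸 A) ^ k) B) t := fun k _ =>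
        ((hasDerivAt_pow k t).const_mul _).smul_const _
      refine (HasDerivAt.fun_sum this).congr_deriv ?_
      rw [sum_range_succ']
      simp only [Nat.cast_zero, zero_mul, mul_zero, zero_smul, add_zero]
      refine sum_congr rfl fun k _ => ?_
      rw [pow_succ (ad ℝ 𝔸 A), Module.End.mul_apply, LieAlgebra.ad_apply, Nat.factorial_succ]
      congr 1
      have : (k.factorial : ℝ) ≠ 0 := by positivity
      have : (k + 1 : ℝ) ≠ 0 := by positivity
      push_cast
      field_simp
    · rw [sum_range_succ']
      simp

theorem exp_mul_eq_sum_mul_exp (A B : 𝔸) (n : ℕ) (h : ((ad ℝ 𝔸 A) ^ n) B = 0) :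
    exp A * B = (∑ k ∈ range n, (k.factorial : ℝ)⁻¹ • ((ad ℝ 𝔸 A) ^ k) B) * exp A := by
  have h1 := exp_smul_conj A n B h 1
  simp only [one_smul, one_pow, mul_one] at h1
  have h2 := exp_neg_smul_mul_exp_smul A 1
  rw [one_smul] at h2
  rw [← h1, mul_assoc, h2, mul_one]

/-- The Baker–Campbell–Hausdorff formula when the commutator is central. -/
theorem exp_add_of_commute_lie (A B : 𝔸) (hA : ⁅A, ⁅A, B⁆⁆ = 0) (hB : ⁅B, ⁅A, B⁆⁆ = 0) :
    exp (A + B) = exp A * exp B * exp (-((1 / 2 : ℝ) • ⁅A, B⁆)) := by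
  let _ : NormedAlgebra ℚ 𝔸 := NormedAlgebra.restrictScalars ℚ ℝ 𝔸
  set Z := ⁅A, B⁆ with hZ
  have cA : A * Z = Z * A := by rwa [LieRing.of_associative_ring_bracket, sub_eq_zero] at hA
  have cB : B * Z = Z * B := by rwa [LieRing.of_associative_ring_bracket, sub_eq_zero] at hB
  -- The claim is `F 1 = F 0`. The quadratic coefficient `t ^ 2 / 2` is what cancels the term `t •
  -- Z` produced by moving `B` past `exp (t • A)`.
  let F : ℝ → 𝔸 := fun t => exp (-(t • (A + B))) *
    (exp (t • A) * (exp (t • B) * exp (-((t ^ 2 / 2) • Z))))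
  have hF : ∀ t, HasDerivAt F 0 t := by
    intro t
    have h1 := hasDerivAt_exp_smul_const (𝕂 := ℝ) (-(A + B)) t
    have h2 := hasDerivAt_exp_smul_const' (𝕂 := ℝ) A t
    have h3 := hasDerivAt_exp_smul_const' (𝕂 := ℝ) B t
    have h4 : HasDerivAt (fun t : ℝ => exp (-((t ^ 2 / 2) • Z)))
        (-(t • (Z * exp (-((t ^ 2 / 2) • Z))))) t := by
      have h5 := (hasDerivAt_exp_smul_const' (𝕂 := ℝ) Z (-(t ^ 2 / 2))).scomp t
        (((hasDerivAt_pow 2 t).div_const 2).neg)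
      simp only [Function.comp_def] at h5
      have h6 : ∀ s : ℝ, exp (-((s ^ 2 / 2) • Z)) = exp ((-(s ^ 2 / 2)) • Z) := fun s => by
        rw [neg_smul]
      simp only [h6]
      refine h5.congr_deriv ?_
      rw [← neg_smul]
      congr 1
      simp
    have h := h1.mul (h2.mul (h3.mul h4))
    simp only [smul_neg] at h
    refine h.congr_deriv ?_
    simp only [Pi.mul_apply]
    have e1 : exp (t • A) * B = (B + t • Z) * exp (t • A) := by
      have := exp_mul_eq_sum_mul_exp (t • A) B 2 (by
        simp only [pow_two, Module.End.mul_apply, LieAlgebra.ad_apply, smul_lie, lie_smul]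
        rw [hA]; simp)
      simpa [sum_range_succ] using this
    have e2 : ∀ s : ℝ, Commute Z (exp (s • A)) := fun s =>
      ((show Commute Z A from cA.symm).smul_right s).exp_right
    have e3 : ∀ s : ℝ, Commute Z (exp (s • B)) := fun s =>
      ((show Commute Z B from cB.symm).smul_right s).exp_right
    have e4 : Z * exp (t • A) = exp (t • A) * Z := e2 t
    have e5 : Z * exp (t • B) = exp (t • B) * Z := e3 t
    generalize exp (t • A) = a at *
    generalize exp (t • B) = c at *
    generalize exp (-(t • (A + B))) = d at *
    generalize exp (-((t ^ 2 / 2) • Z)) = z at *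
    have e6 : a * (B * c * z) = B * a * c * z + t • (Z * a * c * z) := by
      rw [← mul_assoc, ← mul_assoc, e1]
      simp only [add_mul, smul_mul_assoc]
    have e7 : a * (c * -(t • (Z * z))) = -(t • (Z * a * c * z)) := by
      rw [mul_neg, mul_neg, mul_smul_comm, mul_smul_comm, ← mul_assoc c, ← e5, ← mul_assoc, ← mul_assoc,
        ← e4]
    rw [mul_add a, e6, e7]
    noncomm_ring
  have h := is_const_of_deriv_eq_zero (f := F) (𝕜 := ℝ) (fun t => (hF t).differentiableAt)
    (fun t => (hF t).deriv) 1 0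
  have h' := congrArg (exp ((1 : ℝ) • (A + B)) * ·) h
  simp only [F, ← mul_assoc, exp_smul_mul_exp_neg_smul] at h'
  simpa [mul_assoc] using h'.symm

end Banach

/-! ### Transfer to matrices, with an auxiliary operator norm that the statements do not see. -/

section MatrixExp
open NormedSpace Finset
variable {𝕜 : Type*} [RCLike 𝕜] {m : ℕ}

theorem matrix_exp_mul_eq_sum_mul_exp (A B : Matrix (Fin m) (Fin m) 𝕜) (n : ℕ)
    (h : ((ad ℝ (Matrix (Fin m) (Fin m) 𝕜) A) ^ n) B = 0) :
    exp A * B = (∑ k ∈ range n, (k.factorial : ℝ)⁻¹ •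
      ((ad ℝ (Matrix (Fin m) (Fin m) 𝕜) A) ^ k) B) * exp A :=
  open scoped Matrix.Norms.Operator in exp_mul_eq_sum_mul_exp A B n h

theorem matrix_exp_add_of_commute_lie (A B : Matrix (Fin m) (Fin m) 𝕜)
    (hA : ⁅A, ⁅A, B⁆⁆ = 0) (hB : ⁅B, ⁅A, B⁆⁆ = 0) :
    exp (A + B) = exp A * exp B * exp (-((1 / 2 : ℝ) • ⁅A, B⁆)) :=
  open scoped Matrix.Norms.Operator in exp_add_of_commute_lie A B hA hB

/-- If `A B = C A`, then `A (exp B) = (exp C) A`. -/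
theorem matrix_mul_exp_of_mul_eq (A B C : Matrix (Fin m) (Fin m) 𝕜) (h : A * B = C * A) :
    A * exp B = exp C * A := by
  open scoped Matrix.Norms.Operator in exact (SemiconjBy.exp_right (show SemiconjBy A B C from h))

theorem matrix_exp_map_ofReal (A : Matrix (Fin m) (Fin m) ℝ) :
    (exp A).map Complex.ofRealHom = exp (A.map Complex.ofRealHom) := by
  open scoped Matrix.Norms.Operator in
  exact map_exp Complex.ofRealHom.mapMatrix
    (continuous_id.matrix_map Complex.continuous_ofReal) A

/-- The hypothesis says that `B` intertwines `A + c` with `A`. Hence it intertwines their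
exponentials, and the scalar `c` splits off. -/
theorem matrix_exp_mul_of_lie_eq_smul {A B : Matrix (Fin m) (Fin m) ℂ} {c : ℂ}
    (h : A * B - B * A = c • B) : exp A * B = Complex.exp c • (B * exp A) := by
  have h1 : B * (A + c • (1 : Matrix (Fin m) (Fin m) ℂ)) = A * B := by
    rw [mul_add, mul_smul_comm, mul_one, ← h]; abel
  rw [← matrix_mul_exp_of_mul_eq _ _ _ h1,
    Matrix.exp_add_of_commute _ _ ((Commute.one_right A).smul_right c)]
  have h2 : exp (c • (1 : Matrix (Fin m) (Fin m) ℂ)) = Complex.exp c • 1 := by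
    rw [← Algebra.algebraMap_eq_smul_one, Complex.exp_eq_exp_ℂ, ← Algebra.algebraMap_eq_smul_one]
    open scoped Matrix.Norms.Operator in
    exact (algebraMap_exp_comm (𝕂 := ℂ) c).symm
  rw [h2, mul_smul_comm, mul_one, mul_smul_comm]

end MatrixExp


/-! ### Roots and root vectors -/

section RootVectors

variable {L : Type*} [LieRing L] [LieAlgebra ℝ L] [FiniteDimensional ℝ L] [IsKilling ℝ L]
  {H : LieSubalgebra ℝ L} [H.IsCartanSubalgebra] [LieModule.IsTriangularizable ℝ H L]

theorem negRoot_negRoot (α : H.root) : negRoot (negRoot α) = α :=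
  Subtype.ext (neg_neg α.1)

theorem root_negRoot (α : H.root) :
    (rootSystem H).root (negRoot α) = -(rootSystem H).root α := by
  ext h; simp [negRoot]

theorem coroot_negRoot (α : H.root) : coroot (negRoot α).1 = -coroot α.1 := coroot_neg α.1

theorem combRoot_spec {a b : ℤ} {α β : H.root} (h : IsRootComb a b α β) :
    (rootSystem H).root (combRoot a b α β) =
      a • (rootSystem H).root α + b • (rootSystem H).root β := by
  rw [combRoot, dif_pos h]; exact h.choose_spec

theorem combRoot_eq {a b : ℤ} {α β γ : H.root} (h : (rootSystem H).root γ =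
      a • (rootSystem H).root α + b • (rootSystem H).root β) : combRoot a b α β = γ :=
  (rootSystem H).root.injective <| (combRoot_spec ⟨γ, h⟩).trans h.symm

theorem root_apply (α : H.root) (h : H) : (rootSystem H).root α h = α.1 h := rfl

theorem pairingIn_cast (α β : H.root) :
    (((rootSystem H).pairingIn ℤ β α : ℤ) : ℝ) = β.1 (coroot α.1) := by
  have := (rootSystem H).algebraMap_pairingIn ℤ β α
  simpa using this

theorem root_reflRoot (α β : H.root) :
    (rootSystem H).root (reflRoot α β) =
      (rootSystem H).root β - (rootSystem H).pairingIn ℤ β α • (rootSystem H).root α := by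
  rw [reflRoot, RootPairing.root_reflectionPerm, RootPairing.reflection_apply_root' ℤ]

theorem reflRoot_apply (α β : H.root) (h : H) :
    (reflRoot α β).1 h = β.1 h - β.1 (coroot α.1) * α.1 h := by
  have := LinearMap.congr_fun (root_reflRoot α β) h
  rw [← pairingIn_cast, ← root_apply, this]
  simp

theorem coroot_reflRoot (α β : H.root) :
    coroot (reflRoot α β).1 = coroot β.1 - α.1 (coroot β.1) • coroot α.1 := by
  have := (rootSystem H).coroot_reflectionPerm α β
  rw [RootPairing.coreflection_apply_coroot] at this
  exact this

theorem reflRoot_negRoot (α β : H.root) : reflRoot α (negRoot β) = negRoot (reflRoot α β) := by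
  apply (rootSystem H).root.injective
  rw [root_negRoot, reflRoot, RootPairing.root_reflectionPerm, root_negRoot, map_neg,
    ← RootPairing.root_reflectionPerm, reflRoot]

theorem reflRoot_self (α : H.root) : reflRoot α α = negRoot α := by
  apply (rootSystem H).root.injective
  rw [root_negRoot, reflRoot, RootPairing.root_reflectionPerm, RootPairing.reflection_apply_self]

theorem mem_rootSpace_iff {χ : H → ℝ} {y : L} :
    y ∈ rootSpace H χ ↔ ∀ h : H, ⁅(h : L), y⁆ = χ h • y := by
  refine ⟨fun hy h => lie_eq_smul_of_mem_rootSpace hy h, fun hy => ?_⟩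
  exact LieModule.weightSpace_le_genWeightSpace L χ ((LieModule.mem_weightSpace χ y).2 hy)

omit [IsKilling ℝ L] [LieModule.IsTriangularizable ℝ H L] in
theorem exists_root_of_mem_rootSpace {χ : H → ℝ} {y : L} (hy : y ∈ rootSpace H χ) (hy0 : y ≠ 0)
    (hχ : χ ≠ 0) : ∃ γ : H.root, ∀ h, γ.1 h = χ h := by
  have hne : rootSpace H χ ≠ ⊥ := fun hb => hy0 (by simpa [hb] using hy)
  refine ⟨⟨⟨χ, hne⟩, ?_⟩, fun h => rfl⟩
  simp only [LieSubalgebra.root, Finset.mem_filter, Finset.mem_univ, true_and]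
  intro h0
  exact hχ h0

theorem linearIndependent_root {α β : H.root} (h1 : β ≠ α) (h2 : β ≠ negRoot α) :
    LinearIndependent ℝ ![(rootSystem H).root α, (rootSystem H).root β] := by
  refine RootPairing.IsReduced.linearIndependent _ h1.symm fun h => h2 ?_
  apply (rootSystem H).root.injective
  rw [root_negRoot, h, neg_neg]

theorem isRootComb_iff_mem_range {a b : ℤ} {α β : H.root} : IsRootComb a b α β ↔
    a • (rootSystem H).root α + b • (rootSystem H).root β ∈ Set.range (rootSystem H).root :=
  Iff.rfl

theorem isRootComb_one_iff {α β : H.root}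
    (h : LinearIndependent ℝ ![(rootSystem H).root α, (rootSystem H).root β]) (k : ℤ) :
    IsRootComb k 1 α β ↔ -((rootSystem H).chainBotCoeff α β : ℤ) ≤ k ∧
      k ≤ (rootSystem H).chainTopCoeff α β := by
  rw [isRootComb_iff_mem_range, one_smul, add_comm,
    RootPairing.root_add_zsmul_mem_range_iff h, Set.mem_Icc]

theorem isRootComb_comm {a b : ℤ} {α β : H.root} : IsRootComb a b α β ↔ IsRootComb b a β α := by
  rw [isRootComb_iff_mem_range, isRootComb_iff_mem_range, add_comm]

theorem combRoot_comm (a b : ℤ) {α β : H.root} (h : IsRootComb a b α β) :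
    combRoot a b α β = combRoot b a β α := by
  symm
  apply combRoot_eq
  rw [combRoot_spec h, add_comm]

namespace ChevalleySystem

variable (E : ChevalleySystem H)

theorem lie_coe_e (h : H) (α : H.root) : ⁅(h : L), E.e α⁆ = α.1 h • E.e α :=
  mem_rootSpace_iff.1 (E.e_mem α) h

theorem coroot_ne_zero (α : H.root) : (coroot α.1 : L) ≠ 0 := by
  have h : coroot α.1 ≠ 0 := by
    rw [Ne, coroot_eq_zero_iff]; exact H.isNonZero_coe_root α
  simp [h]

theorem e_ne_zero (α : H.root) : E.e α ≠ 0 := fun h =>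
  coroot_ne_zero α (by rw [← E.lie_e_neg, h, zero_lie])

theorem root_apply_coroot_self (α : H.root) : α.1 (coroot α.1) = 2 :=
  root_apply_coroot (H.isNonZero_coe_root α)

theorem isSl2Triple (α : H.root) :
    IsSl2Triple (coroot α.1 : L) (E.e α) (E.e (negRoot α)) where
  h_ne_zero := coroot_ne_zero α
  lie_e_f := E.lie_e_neg α
  lie_h_e_nsmul := by
    rw [E.lie_coe_e, root_apply_coroot_self, ← Nat.cast_smul_eq_nsmul ℝ]; simp
  lie_h_f_nsmul := by
    have h : (negRoot α).1 (coroot α.1) = -2 := by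
      rw [← root_apply_coroot_self α]; rfl
    rw [E.lie_coe_e, h, ← Nat.cast_smul_eq_nsmul ℝ]; simp

theorem exists_eq_smul_e {γ : H.root} {y : L} (hy : y ∈ rootSpace H γ.1) :
    ∃ c : ℝ, y = c • E.e γ := by
  have h1 := finrank_rootSpace_eq_one γ.1 (H.isNonZero_coe_root γ)
  have h2 : (⟨E.e γ, E.e_mem γ⟩ : rootSpace H γ.1) ≠ 0 := fun h =>
    E.e_ne_zero γ (congrArg Subtype.val h)
  obtain ⟨c, hc⟩ := (finrank_eq_one_iff_of_nonzero' _ h2).1 h1 ⟨y, hy⟩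
  exact ⟨c, (congrArg Subtype.val hc).symm⟩

theorem isNilpotent_ad (α : H.root) : IsNilpotent (ad ℝ L (E.e α)) := by
  refine LieAlgebra.isNilpotent_ad_of_mem_rootSpace H (χ := α.1) ?_ (E.e_mem α)
  intro h
  exact H.isNonZero_coe_root α h

theorem lie_e_mem {χ χ' : H → ℝ} {α : H.root} {y : L} (hy : y ∈ rootSpace H χ)
    (h : ∀ x, χ' x = α.1 x + χ x) : ⁅E.e α, y⁆ ∈ rootSpace H χ' := by
  rw [show χ' = (α.1 : H → ℝ) + χ from funext h]
  exact lie_mem_genWeightSpace_of_mem_genWeightSpace (E.e_mem α) hy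

theorem lie_e_e_of_isRootComb {α β : H.root} (h : IsRootComb 1 1 α β) :
    ⁅E.e α, E.e β⁆ = E.N α β • E.e (combRoot 1 1 α β) := by
  have h2 : ∃ c : ℝ, ⁅E.e α, E.e β⁆ = c • E.e (combRoot 1 1 α β) := by
    refine E.exists_eq_smul_e (E.lie_e_mem (E.e_mem β) fun x => ?_)
    have := LinearMap.congr_fun (combRoot_spec h) x
    simpa [root_apply] using this
  have h3 : IsRootComb 1 1 α β ∧ ∃ c : ℝ, ⁅E.e α, E.e β⁆ = c • E.e (combRoot 1 1 α β) := ⟨h, h2⟩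
  rw [N, dif_pos h3]
  exact h3.2.choose_spec

/-- A vector of weight `a α + b β ≠ 0` vanishes if this is not a root. -/
theorem eq_zero_of_not_isRootComb {a b : ℤ} {α β : H.root}
    (hli : LinearIndependent ℝ ![(rootSystem H).root α, (rootSystem H).root β])
    (hab : a ≠ 0 ∨ b ≠ 0) (h : ¬ IsRootComb a b α β) {χ : H → ℝ}
    (hχ : ∀ x, χ x = a * α.1 x + b * β.1 x) {y : L} (hy : y ∈ rootSpace H χ) : y = 0 := by
  by_contra hy0
  have hχ0 : χ ≠ 0 := by
    intro h0
    have h1 : (a : ℝ) • (rootSystem H).root α + (b : ℝ) • (rootSystem H).root β = 0 := by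
      ext x
      have := hχ x
      rw [h0] at this
      simpa [root_apply] using this.symm
    obtain ⟨h2, h3⟩ := LinearIndependent.pair_iff.1 hli _ _ h1
    norm_cast at h2 h3
    tauto
  obtain ⟨γ, hγ⟩ := exists_root_of_mem_rootSpace hy hy0 hχ0
  refine h ⟨γ, ?_⟩
  ext x
  simp [hγ, hχ]

theorem ad_pow_e_mem (α β : H.root) (k : ℕ) {χ : H → ℝ} (hχ : ∀ x, χ x = k * α.1 x + β.1 x) :
    ((ad ℝ L (E.e α)) ^ k) (E.e β) ∈ rootSpace H χ := by
  induction k generalizing χ with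
  | zero =>
    rw [show χ = β.1 from funext fun x => by simp [hχ]]
    exact E.e_mem β
  | succ k ih =>
    rw [pow_succ', Module.End.mul_apply, LieAlgebra.ad_apply]
    refine E.lie_e_mem (ih (χ := fun x => k * α.1 x + β.1 x) fun x => rfl) fun x => ?_
    rw [hχ]; push_cast; ring

theorem ad_pow_e_eq_zero {α β : H.root}
    (hli : LinearIndependent ℝ ![(rootSystem H).root α, (rootSystem H).root β])
    {k : ℕ} (h : ¬ IsRootComb k 1 α β) : ((ad ℝ L (E.e α)) ^ k) (E.e β) = 0 :=
  eq_zero_of_not_isRootComb hli (Or.inr one_ne_zero) h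
    (χ := fun x => k * α.1 x + β.1 x) (by simp) (E.ad_pow_e_mem α β k fun x => rfl)

theorem ad_pow_e_eq {α β : H.root}
    (hli : LinearIndependent ℝ ![(rootSystem H).root α, (rootSystem H).root β])
    {k : ℕ} (h : IsRootComb k 1 α β) : ((ad ℝ L (E.e α)) ^ k) (E.e β) =
      (∏ l ∈ Finset.range k, E.N α (combRoot l 1 α β)) • E.e (combRoot k 1 α β) := by
  induction k with
  | zero =>
    rw [combRoot_eq (γ := β) (by simp)]; simp
  | succ k ih =>
    have hk : IsRootComb k 1 α β := by
      rw [isRootComb_one_iff hli] at h ⊢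
      push_cast at h; omega
    have h1 : (rootSystem H).root (combRoot ((k + 1 : ℕ) : ℤ) 1 α β) =
        (1 : ℤ) • (rootSystem H).root α + (1 : ℤ) • (rootSystem H).root (combRoot k 1 α β) := by
      rw [combRoot_spec h, combRoot_spec hk]; push_cast; module
    rw [pow_succ', Module.End.mul_apply, LieAlgebra.ad_apply, ih hk, lie_smul,
      E.lie_e_e_of_isRootComb ⟨_, h1⟩, combRoot_eq h1, smul_smul, Finset.prod_range_succ]

theorem ad_pow_e_eq_M {α β : H.root}
    (hli : LinearIndependent ℝ ![(rootSystem H).root α, (rootSystem H).root β])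
    {k : ℕ} (h : IsRootComb k 1 α β) :
    (k.factorial : ℝ)⁻¹ • ((ad ℝ L (E.e α)) ^ k) (E.e β) = E.M α β k • E.e (combRoot k 1 α β) := by
  rw [E.ad_pow_e_eq hli h, smul_smul, M]

end ChevalleySystem

end RootVectors


/-! ### The adjoint action -/

section Adjoint

section

variable {L : Type*} [LieRing L] [LieAlgebra ℝ L] [FiniteDimensional ℝ L]

variable (L) in
/-- The adjoint representation in matrix form. -/
def adMatRep : MatRep L :=
  ⟨Module.finrank ℝ L, ((LinearMap.toMatrixAlgEquiv (Module.finBasis ℝ L) :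
    Module.End ℝ L →ₐ[ℝ] Matrix (Fin (Module.finrank ℝ L)) (Fin (Module.finrank ℝ L)) ℝ) :
    Module.End ℝ L →ₗ⁅ℝ⁆ Matrix (Fin (Module.finrank ℝ L)) (Fin (Module.finrank ℝ L)) ℝ).comp
    (ad ℝ L)⟩

theorem adMatRep_injective [IsKilling ℝ L] : Function.Injective (adMatRep L).2 := by
  intro X Y h
  have h1 : ad ℝ L X = ad ℝ L Y :=
    (LinearMap.toMatrixAlgEquiv (Module.finBasis ℝ L)).injective h
  have h2 : (ad ℝ L).ker = ⊥ := by
    rw [LieAlgebra.ad_ker_eq_self_module_ker, LieModule.ker_eq_bot]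
  exact (LieHom.ker_eq_bot _).1 h2 h1

omit [FiniteDimensional ℝ L] in
theorem matRep_ad_pow (ρ : MatRep L) (X Y : L) (k : ℕ) :
    ρ.2 (((ad ℝ L X) ^ k) Y) = ((ad ℝ (Matrix (Fin ρ.1) (Fin ρ.1) ℝ) (ρ.2 X)) ^ k) (ρ.2 Y) := by
  induction k with
  | zero => simp
  | succ k ih => simp [pow_succ', ih]

omit [FiniteDimensional ℝ L] in
theorem expAll_mul_eq (ρ : MatRep L) (X Y : L) (n : ℕ) (h : ((ad ℝ L X) ^ n) Y = 0) :
    (expAll X ρ : Matrix (Fin ρ.1) (Fin ρ.1) ℝ) * ρ.2 Y =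
      ρ.2 (∑ k ∈ Finset.range n, (k.factorial : ℝ)⁻¹ • ((ad ℝ L X) ^ k) Y) *
        (expAll X ρ : Matrix (Fin ρ.1) (Fin ρ.1) ℝ) := by
  have := matrix_exp_mul_eq_sum_mul_exp (ρ.2 X) (ρ.2 Y) n (by rw [← matRep_ad_pow, h, map_zero])
  simp only [← matRep_ad_pow, ← map_smul ρ.2, ← map_sum] at this
  exact this

/-- The relation between an element of the group and a linear map of the Lie algebra that
expresses that the latter is the adjoint action of the former. -/
def IsAd (g : AllGL L) (φ : L →ₗ[ℝ] L) : Prop :=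
  ∀ (ρ : MatRep L) (Y : L), (g ρ : Matrix (Fin ρ.1) (Fin ρ.1) ℝ) * ρ.2 Y =
    ρ.2 (φ Y) * (g ρ : Matrix (Fin ρ.1) (Fin ρ.1) ℝ)

omit [FiniteDimensional ℝ L] in
theorem IsAd.one : IsAd (1 : AllGL L) LinearMap.id := fun ρ Y => by
  rw [Pi.one_apply, Units.val_one, one_mul, mul_one, LinearMap.id_apply]

omit [FiniteDimensional ℝ L] in
theorem IsAd.mul {g g' : AllGL L} {φ φ' : L →ₗ[ℝ] L} (h : IsAd g φ) (h' : IsAd g' φ') :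
    IsAd (g * g') (φ.comp φ') := fun ρ Y => by
  rw [Pi.mul_apply, Units.val_mul, mul_assoc, h' ρ Y, ← mul_assoc, h ρ, mul_assoc,
    LinearMap.comp_apply]

/-- The adjoint representation alone decides: it is faithful because the Killing form is
nondegenerate, and the matrix of `g` can be cancelled. Every identity about `Ad` below is obtained
this way. -/
theorem IsAd.apply_eq_of_mul_eq [IsKilling ℝ L] {g : AllGL L} {φ : L →ₗ[ℝ] L} (h : IsAd g φ)
    {Y Z : L} (hYZ : ∀ ρ : MatRep L, (g ρ : Matrix (Fin ρ.1) (Fin ρ.1) ℝ) * ρ.2 Y =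
      ρ.2 Z * (g ρ : Matrix (Fin ρ.1) (Fin ρ.1) ℝ)) : φ Y = Z := by
  apply adMatRep_injective
  have := (h (adMatRep L) Y).symm.trans (hYZ (adMatRep L))
  exact (Units.isUnit (g (adMatRep L))).mul_left_injective this

end

variable {L : Type*} [LieRing L] [LieAlgebra ℝ L] [FiniteDimensional ℝ L] [IsKilling ℝ L]
  {H : LieSubalgebra ℝ L} [H.IsCartanSubalgebra] [LieModule.IsTriangularizable ℝ H L]
  (E : ChevalleySystem H)

namespace ChevalleySystem

theorem isAd_χ (α : H.root) (x : ℝ) : ∃ φ, IsAd (E.χ α x : AllGL L) φ := by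
  obtain ⟨n, hn⟩ := E.isNilpotent_ad α
  refine ⟨∑ k ∈ Finset.range n, (k.factorial : ℝ)⁻¹ • (ad ℝ L (x • E.e α)) ^ k, fun ρ Y => ?_⟩
  have h := expAll_mul_eq ρ (x • E.e α) Y n (by
    rw [map_smul, smul_pow, hn, smul_zero, LinearMap.zero_apply])
  rw [LinearMap.sum_apply]
  exact h

theorem χ_zero (α : H.root) : E.χ α 0 = 1 := by
  refine Subtype.ext (funext fun ρ => Units.ext ?_)
  change NormedSpace.exp (ρ.2 ((0 : ℝ) • E.e α)) = 1
  simp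

theorem χ_add (α : H.root) (x y : ℝ) : E.χ α (x + y) = E.χ α x * E.χ α y := by
  refine Subtype.ext (funext fun ρ => Units.ext ?_)
  change NormedSpace.exp (ρ.2 ((x + y) • E.e α)) =
    NormedSpace.exp (ρ.2 (x • E.e α)) * NormedSpace.exp (ρ.2 (y • E.e α))
  rw [add_smul, map_add, Matrix.exp_add_of_commute]
  rw [map_smul, map_smul]
  exact ((Commute.refl _).smul_left x).smul_right y

theorem χ_neg (α : H.root) (x : ℝ) : E.χ α (-x) = (E.χ α x)⁻¹ := by
  rw [eq_inv_iff_mul_eq_one, ← χ_add, neg_add_cancel, χ_zero]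

/-- No hypothesis on inverses is needed, because `χ_α(x)⁻¹ = χ_α(-x)` is again a generator. -/
theorem closure_χ_induction {p : E.G → Prop} (h : ∀ α x, p (E.χ α x)) (h1 : p 1)
    (hm : ∀ g g', p g → p g' → p (g * g')) (g : E.G) : p g := by
  obtain ⟨g, hg⟩ := g
  induction hg using Subgroup.closure_induction'' with
  | mem g hg => obtain ⟨α, x, rfl⟩ := hg; exact h α x
  | inv_mem g hg =>
    obtain ⟨α, x, rfl⟩ := hg
    have := h α (-x)
    rw [χ_neg] at this
    exact this
  | one => exact h1
  | mul g g' hg hg' ih ih' => exact hm _ _ ih ih'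

theorem exists_isAd (g : E.G) : ∃ φ, IsAd (g : AllGL L) φ :=
  E.closure_χ_induction (p := fun g => ∃ φ, IsAd (g : AllGL L) φ) E.isAd_χ ⟨_, IsAd.one⟩
    (fun _ _ ⟨_, h⟩ ⟨_, h'⟩ => ⟨_, h.mul h'⟩) g

/-- The adjoint action of `G` on `L`. -/
def Ad (g : E.G) : L →ₗ[ℝ] L := (E.exists_isAd g).choose

theorem isAd_Ad (g : E.G) : IsAd (g : AllGL L) (E.Ad g) := (E.exists_isAd g).choose_spec

theorem Ad_one (Y : L) : E.Ad 1 Y = Y := (E.isAd_Ad 1).apply_eq_of_mul_eq fun ρ => IsAd.one ρ Y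

theorem Ad_mul (g g' : E.G) (Y : L) : E.Ad (g * g') Y = E.Ad g (E.Ad g' Y) :=
  (E.isAd_Ad (g * g')).apply_eq_of_mul_eq fun ρ => ((E.isAd_Ad g).mul (E.isAd_Ad g')) ρ Y

theorem Ad_inv_Ad (g : E.G) (Y : L) : E.Ad g⁻¹ (E.Ad g Y) = Y := by
  rw [← Ad_mul, inv_mul_cancel, Ad_one]

theorem Ad_Ad_inv (g : E.G) (Y : L) : E.Ad g (E.Ad g⁻¹ Y) = Y := by
  rw [← Ad_mul, mul_inv_cancel, Ad_one]

theorem Ad_lie (g : E.G) (X Y : L) : E.Ad g ⁅X, Y⁆ = ⁅E.Ad g X, E.Ad g Y⁆ := by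
  refine (E.isAd_Ad g).apply_eq_of_mul_eq fun ρ => ?_
  have h := E.isAd_Ad g ρ
  rw [LieHom.map_lie, LieHom.map_lie, LieRing.of_associative_ring_bracket,
    LieRing.of_associative_ring_bracket, mul_sub, sub_mul, ← mul_assoc, ← mul_assoc, h X, h Y,
    mul_assoc, mul_assoc, h X, h Y, mul_assoc, mul_assoc]

theorem Ad_χ (α : H.root) (x : ℝ) (Y : L) (n : ℕ) (h : ((ad ℝ L (E.e α)) ^ n) Y = 0) :
    E.Ad (E.χ α x) Y =
      ∑ k ∈ Finset.range n, ((k.factorial : ℝ)⁻¹ * x ^ k) • ((ad ℝ L (E.e α)) ^ k) Y := by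
  refine (E.isAd_Ad _).apply_eq_of_mul_eq fun ρ => ?_
  have h1 := expAll_mul_eq ρ (x • E.e α) Y n (by rw [map_smul, smul_pow, LinearMap.smul_apply, h,
    smul_zero])
  simp only [map_smul, smul_pow, LinearMap.smul_apply, smul_smul] at h1
  exact h1

theorem invol_Ad (g : E.G) (Y : L) : E.invol (E.Ad g Y) = E.Ad (E.θ g) (E.invol Y) := by
  symm
  refine (E.isAd_Ad _).apply_eq_of_mul_eq fun ρ => ?_
  exact E.isAd_Ad g ⟨ρ.1, ρ.2.comp (E.invol : L →ₗ⁅ℝ⁆ L)⟩ Y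

theorem conj_expAll (g : E.G) (Y : L) :
    (g : AllGL L) * expAll Y * (g : AllGL L)⁻¹ = expAll (E.Ad g Y) := by
  rw [mul_inv_eq_iff_eq_mul]
  refine funext fun ρ => Units.ext ?_
  exact matrix_mul_exp_of_mul_eq _ _ _ (E.isAd_Ad g ρ Y)

theorem conj_χ (g : E.G) {α β : H.root} {c : ℝ} (h : E.Ad g (E.e α) = c • E.e β) (x : ℝ) :
    g * E.χ α x * g⁻¹ = E.χ β (c * x) := by
  refine Subtype.ext ?_
  have := E.conj_expAll g (x • E.e α)
  rw [map_smul, h, smul_smul, mul_comm x] at this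
  exact this

/-! ### Rank one -/

theorem Ad_χ_self (α : H.root) (x : ℝ) : E.Ad (E.χ α x) (E.e α) = E.e α := by
  rw [E.Ad_χ α x _ 1 (by simp)]; simp

theorem Ad_χ_coe (α : H.root) (x : ℝ) (h : H) :
    E.Ad (E.χ α x) (h : L) = (h : L) - (x * α.1 h) • E.e α := by
  have h1 : ⁅E.e α, (h : L)⁆ = -(α.1 h • E.e α) := by rw [← lie_skew, E.lie_coe_e]
  rw [E.Ad_χ α x _ 2 (by simp [pow_two, h1])]
  simp [Finset.sum_range_succ, h1, smul_smul, sub_eq_add_neg]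

theorem Ad_χ_neg (α : H.root) (x : ℝ) : E.Ad (E.χ α x) (E.e (negRoot α)) =
    E.e (negRoot α) + x • (coroot α.1 : L) - x ^ 2 • E.e α := by
  have h1 := E.lie_e_neg α
  have h2 : ⁅E.e α, (coroot α.1 : L)⁆ = -((2 : ℝ) • E.e α) := by
    rw [← lie_skew, E.lie_coe_e, root_apply_coroot_self]
  rw [E.Ad_χ α x _ 3 (by simp [pow_succ, h1, h2])]
  simp [Finset.sum_range_succ, h1, h2, smul_smul, sub_eq_add_neg, pow_two]
  module

theorem Ad_w_coe (α : H.root) (h : H) : E.Ad (E.w α) (h : L) = h - α.1 h • (coroot α.1 : L) := by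
  have hneg : ∀ h, (negRoot α).1 h = -α.1 h := fun _ => rfl
  have h2 := E.Ad_χ_neg (negRoot α) (-1)
  rw [negRoot_negRoot, coroot_negRoot] at h2
  simp only [w, wt, Ad_mul, Ad_χ_coe, map_sub, map_smul, hneg, inv_one, h2, Ad_χ_self, map_add,
    NegMemClass.coe_neg, map_neg, Ad_χ_neg, root_apply_coroot_self]
  module

theorem Ad_w_e (α : H.root) : E.Ad (E.w α) (E.e α) = -E.e (negRoot α) := by
  have h2 := E.Ad_χ_neg (negRoot α) (-1)
  rw [negRoot_negRoot, coroot_negRoot] at h2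
  simp only [w, wt, Ad_mul, Ad_χ_coe, map_sub, map_smul, inv_one, h2, Ad_χ_self, map_add,
    NegMemClass.coe_neg, map_neg, Ad_χ_neg, root_apply_coroot_self]
  module

theorem Ad_w_e_neg (α : H.root) : E.Ad (E.w α) (E.e (negRoot α)) = -E.e α := by
  have hneg : ∀ h, (negRoot α).1 h = -α.1 h := fun _ => rfl
  have h2 := E.Ad_χ_neg (negRoot α) (-1)
  rw [negRoot_negRoot, coroot_negRoot] at h2
  simp only [w, wt, Ad_mul, Ad_χ_coe, map_sub, map_smul, hneg, inv_one, h2, Ad_χ_self, map_add,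
    NegMemClass.coe_neg, map_neg, Ad_χ_neg, root_apply_coroot_self]
  module

theorem Ad_w_inv_coe (α : H.root) (h : H) :
    E.Ad (E.w α)⁻¹ (h : L) = h - α.1 h • (coroot α.1 : L) := by
  have h1 : E.Ad (E.w α) ((h : L) - α.1 h • (coroot α.1 : L)) = h := by
    rw [map_sub, map_smul, Ad_w_coe, Ad_w_coe, root_apply_coroot_self]
    module
  rw [← h1, Ad_inv_Ad, h1]

theorem Ad_w_inv_e (α : H.root) : E.Ad (E.w α)⁻¹ (E.e α) = -E.e (negRoot α) := by
  rw [← neg_eq_iff_eq_neg, ← map_neg, ← Ad_w_e_neg, Ad_inv_Ad]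

theorem Ad_w_inv_e_neg (α : H.root) : E.Ad (E.w α)⁻¹ (E.e (negRoot α)) = -E.e α := by
  rw [← neg_eq_iff_eq_neg, ← map_neg, ← Ad_w_e, Ad_inv_Ad]

theorem w_conj_χ (α : H.root) (x : ℝ) :
    E.w α * E.χ α x * (E.w α)⁻¹ = E.χ (negRoot α) (-x) := by
  rw [E.conj_χ _ (c := -1) (β := negRoot α) (by rw [Ad_w_e, neg_one_smul]), neg_one_mul]

theorem w_conj_χ_neg (α : H.root) (x : ℝ) :
    E.w α * E.χ (negRoot α) x * (E.w α)⁻¹ = E.χ α (-x) := by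
  rw [E.conj_χ _ (c := -1) (β := α) (by rw [Ad_w_e_neg, neg_one_smul]), neg_one_mul]

/-- Conjugation by `w_α` acts on `χ_α` and `χ_{-α}` exactly as `θ` does. Applied to the three
factors of `w_α` itself it gives `θ(w_α) = w_α w_α w_α⁻¹`. -/
theorem θ_w (α : H.root) : E.θ (E.w α) = E.w α := by
  have h : E.w α * E.w α * (E.w α)⁻¹ = E.θ (E.w α) := by
    conv_lhs => enter [1, 2]; rw [w, wt]
    have h1 : ∀ a b c g : E.G, g * (a * b * c) * g⁻¹ = g * a * g⁻¹ * (g * b * g⁻¹) * (g * c * g⁻¹) :=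
      fun a b c g => by group
    rw [h1, w_conj_χ, w_conj_χ_neg, w, wt, map_mul, map_mul, θ_χ, θ_χ, negRoot_negRoot]
  rw [← h, mul_inv_cancel_right]

theorem w_eq_neg (α : H.root) :
    E.w α = E.χ (negRoot α) (-1) * E.χ α 1 * E.χ (negRoot α) (-1) := by
  rw [← θ_w, w, wt, map_mul, map_mul, θ_χ, θ_χ, negRoot_negRoot]
  simp

end ChevalleySystem

end Adjoint


/-! ### The signs `η` -/

section Signs

/-- Only the positivity of this product and its value for `j = k = μ` are used later, to compare
structure constants along a root string. -/
theorem lie_e_pow_lie_f_pow {L : Type*} [LieRing L] [LieAlgebra ℝ L] {h e f m : L} {μ : ℝ}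
    {t : IsSl2Triple h e f} (P : t.HasPrimitiveVectorWith m μ) (j k : ℕ) (hjk : j ≤ k) :
    ((ad ℝ L e) ^ j) (((ad ℝ L f) ^ k) m) =
      (∏ i ∈ Finset.range j, ((k - i : ℝ) * (μ - k + i + 1))) • ((ad ℝ L f) ^ (k - j)) m := by
  induction j with
  | zero => simp
  | succ j ih =>
    have h1 := P.lie_e_pow_succ_toEnd_f (k - (j + 1))
    rw [show k - (j + 1) + 1 = k - j by omega] at h1
    rw [pow_succ', Module.End.mul_apply, ih (by omega), map_smul, LieAlgebra.ad_apply]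
    have h2 : ⁅e, ((ad ℝ L f) ^ (k - j)) m⁆ =
      (((k - (j + 1) : ℕ) + 1 : ℝ) * (μ - (k - (j + 1) : ℕ))) • ((ad ℝ L f) ^ (k - (j + 1))) m := h1
    rw [h2, smul_smul, Finset.prod_range_succ, Nat.cast_sub hjk]
    congr 2
    push_cast
    ring

theorem lie_e_pow_lie_f_pow_eq_zero {L : Type*} [LieRing L] [LieAlgebra ℝ L] {h e f m : L} {μ : ℝ}
    {t : IsSl2Triple h e f} (P : t.HasPrimitiveVectorWith m μ) (j k : ℕ) (hjk : k < j) :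
    ((ad ℝ L e) ^ j) (((ad ℝ L f) ^ k) m) = 0 := by
  obtain ⟨i, rfl⟩ := Nat.exists_eq_add_of_lt hjk
  rw [show k + i + 1 = (i + 1) + k by ring, pow_add, Module.End.mul_apply,
    lie_e_pow_lie_f_pow P k k le_rfl, Nat.sub_self, pow_zero, Module.End.one_apply, map_smul,
    pow_succ, Module.End.mul_apply, LieAlgebra.ad_apply, P.lie_e, map_zero, smul_zero]

/-- The sign of a real number, as a real number. -/
abbrev rsign (x : ℝ) : ℝ := (SignType.sign x : ℝ)

theorem rsign_mul (x y : ℝ) : rsign (x * y) = rsign x * rsign y := by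
  simp [rsign, sign_mul]

theorem rsign_prod {ι : Type*} (s : Finset ι) (f : ι → ℝ) :
    ∏ i ∈ s, rsign (f i) = rsign (∏ i ∈ s, f i) := by
  classical
  induction s using Finset.induction_on with
  | empty => simp [rsign]
  | insert a s ha ih => rw [Finset.prod_insert ha, Finset.prod_insert ha, ih, rsign_mul]

theorem rsign_of_sq_eq_one {x : ℝ} (h : x ^ 2 = 1) : rsign x = x := by
  rw [pow_two] at h
  rcases mul_self_eq_one_iff.1 h with rfl | rfl <;> simp [rsign]

theorem rsign_sq {x : ℝ} (h : x ≠ 0) : rsign x * rsign x = 1 := by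
  rcases lt_or_gt_of_ne h with h | h <;> simp [rsign, h]

variable {L : Type*} [LieRing L] [LieAlgebra ℝ L] [FiniteDimensional ℝ L] [IsKilling ℝ L]
  {H : LieSubalgebra ℝ L} [H.IsCartanSubalgebra] [LieModule.IsTriangularizable ℝ H L]
  (E : ChevalleySystem H)

namespace ChevalleySystem

theorem exists_Ad_w_inv (α β : H.root) :
    ∃ c : ℝ, E.Ad (E.w α)⁻¹ (E.e β) = c • E.e (reflRoot α β) := by
  refine E.exists_eq_smul_e (mem_rootSpace_iff.2 fun h => ?_)
  have h1 : (h : L) = E.Ad (E.w α)⁻¹ ((h - α.1 h • coroot α.1 : H) : L) := by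
    rw [← E.Ad_inv_Ad (E.w α) (h : L), Ad_w_coe]; rfl
  conv_lhs => rw [h1]
  rw [← Ad_lie, lie_coe_e, map_smul, reflRoot_apply]
  congr 1
  have : (rootSystem H).root β (h - α.1 h • coroot α.1) = _ :=
    ((rootSystem H).root β).map_sub _ _
  rw [map_smul] at this
  simp only [root_apply] at this
  rw [this, smul_eq_mul, mul_comm]

/-- The involution commutes with `Ad w_α⁻¹`, since `θ` fixes `w_α`, so the same scalar `c` occurs
for `-β`. Bracketing the two equations compares `c ^ 2` times the coroot of `w_α β` with that
coroot. -/
theorem sq_eq_one_of_Ad_w_inv {α β : H.root} {c : ℝ}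
    (h : E.Ad (E.w α)⁻¹ (E.e β) = c • E.e (reflRoot α β)) : c ^ 2 = 1 := by
  have h1 : E.Ad (E.w α)⁻¹ (E.e (negRoot β)) = c • E.e (negRoot (reflRoot α β)) := by
    have := E.invol_Ad (E.w α)⁻¹ (E.e β)
    rw [h, map_smul, map_inv, θ_w, E.invol_e, E.invol_e, map_neg, smul_neg] at this
    exact (neg_injective this).symm
  have h2 := E.Ad_lie (E.w α)⁻¹ (E.e β) (E.e (negRoot β))
  rw [h, h1, E.lie_e_neg, Ad_w_inv_coe, smul_lie, lie_smul, E.lie_e_neg, smul_smul] at h2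
  have h3 : (coroot β.1 : L) - α.1 (coroot β.1) • (coroot α.1 : L) =
      (coroot (reflRoot α β).1 : L) := by rw [coroot_reflRoot]; rfl
  rw [h3] at h2
  have h4 : (c * c - 1) • (coroot (reflRoot α β).1 : L) = 0 := by
    rw [sub_smul, one_smul, ← h2, sub_self]
  rcases smul_eq_zero.1 h4 with h5 | h5
  · linarith
  · exact absurd h5 (coroot_ne_zero _)

theorem Ad_w_inv_ad_pow (α : H.root) (k : ℕ) (v : L) :
    E.Ad (E.w α)⁻¹ (((ad ℝ L (E.e α)) ^ k) v) =
      (-1 : ℝ) ^ k • ((ad ℝ L (E.e (negRoot α))) ^ k) (E.Ad (E.w α)⁻¹ v) := by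
  induction k with
  | zero => simp
  | succ k ih =>
    rw [pow_succ', Module.End.mul_apply, LieAlgebra.ad_apply, Ad_lie, ih, Ad_w_inv_e, neg_lie,
      lie_smul, pow_succ' (ad ℝ L _), Module.End.mul_apply, LieAlgebra.ad_apply, pow_succ]
    module

/-- On a vector of lowest weight `-n`, the action of `w_α⁻¹` is `(-1)^n e^n / n!`. -/
theorem ad_pow_eq_Ad_w_inv (α : H.root) (n : ℕ) {v : L} (hv0 : v ≠ 0)
    (hf : ⁅E.e (negRoot α), v⁆ = 0) (hh : ⁅(coroot α.1 : L), v⁆ = -(n : ℝ) • v)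
    (he : ((ad ℝ L (E.e α)) ^ (n + 1)) v = 0) :
    ((ad ℝ L (E.e α)) ^ n) v = ((-1 : ℝ) ^ n * n.factorial) • E.Ad (E.w α)⁻¹ v := by
  set u := E.Ad (E.w α)⁻¹ v with hu
  have hu0 : u ≠ 0 := fun h0 => hv0 (by rw [← E.Ad_Ad_inv (E.w α) v, ← hu, h0, map_zero])
  have P : (E.isSl2Triple α).HasPrimitiveVectorWith u (n : ℝ) := by
    refine ⟨hu0, ?_, ?_⟩
    · have := E.Ad_lie (E.w α)⁻¹ (coroot α.1 : L) v
      rw [hh, Ad_w_inv_coe, root_apply_coroot_self, map_smul, ← hu,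
        show (coroot α.1 : L) - (2 : ℝ) • (coroot α.1 : L) = -(coroot α.1 : L) by module,
        neg_lie, neg_smul] at this
      exact (neg_injective this).symm
    · have := E.Ad_lie (E.w α)⁻¹ (E.e (negRoot α)) v
      rw [hf, Ad_w_inv_e_neg, map_zero, neg_lie, eq_comm, neg_eq_zero] at this
      exact this
  have hfu : ((ad ℝ L (E.e (negRoot α))) ^ (n + 1)) u = 0 := by
    have := E.Ad_w_inv_ad_pow α (n + 1) v
    rw [he, map_zero, eq_comm, smul_eq_zero] at this
    exact this.resolve_left (pow_ne_zero _ (by norm_num))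
  -- The form of `w_α` that begins and ends with `χ_{-α}(-1)` is the useful one: `v` is fixed by
  -- `χ_{-α}`, so `u = w_α⁻¹ v` becomes `exp(-e) v = exp(-f) u`.
  have h1 : E.Ad (E.χ α (-1)) v = E.Ad (E.χ (negRoot α) (-1)) u := by
    have h2 : E.Ad (E.χ (negRoot α) 1) v = v := by
      rw [E.Ad_χ _ _ _ 1 (by simp [hf])]; simp
    have h3 : (E.w α)⁻¹ = E.χ (negRoot α) 1 * (E.χ α (-1) * E.χ (negRoot α) 1) := by
      rw [w_eq_neg, χ_neg, χ_neg]; group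
    rw [hu, h3, Ad_mul, Ad_mul, h2, E.χ_neg (negRoot α), Ad_inv_Ad]
  rw [E.Ad_χ _ _ _ (n + 1) he, E.Ad_χ _ _ _ (n + 1) hfu] at h1
  -- Applying `e ^ n` isolates one term on each side: on the left everything beyond `v` dies by
  -- `he`, on the right everything before `f ^ n u` dies because `u` is primitive.
  have h2 := congrArg ((ad ℝ L (E.e α)) ^ n) h1
  rw [map_sum, map_sum, Finset.sum_range_succ', Finset.sum_range_succ, Finset.sum_eq_zero,
    Finset.sum_eq_zero] at h2
  · simp only [zero_add, map_smul, lie_e_pow_lie_f_pow P n n le_rfl] at h2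
    simp only [pow_zero, Nat.factorial_zero, Nat.cast_one, inv_one, mul_one, one_smul,
      Module.End.one_apply, Nat.sub_self, smul_smul] at h2
    rw [h2]
    congr 1
    have h3 : ∀ k : ℕ, ∏ i ∈ Finset.range k, ((i : ℝ) + 1) = k.factorial := fun k => by
      rw [← Finset.prod_range_add_one_eq_factorial]; push_cast; rfl
    have h4 : ∏ i ∈ Finset.range n, ((n - i : ℝ) * (n - n + i + 1)) =
        n.factorial * n.factorial := by
      rw [Finset.prod_mul_distrib]
      congr 1
      · rw [← Finset.prod_range_reflect, ← h3]
        refine Finset.prod_congr rfl fun i hi => ?_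
        have : i < n := Finset.mem_range.1 hi
        rw [Nat.sub_sub, Nat.cast_sub (by omega)]
        push_cast; ring
      · rw [← h3]
        exact Finset.prod_congr rfl fun i _ => by ring
    rw [h4]
    have : (n.factorial : ℝ) ≠ 0 := by positivity
    field_simp
  · intro k hk
    rw [map_smul, lie_e_pow_lie_f_pow_eq_zero P n k (Finset.mem_range.1 hk), smul_zero]
  · intro k _
    rw [map_smul, ← Module.End.mul_apply, ← pow_add, show n + (k + 1) = k + (n + 1) by ring,
      pow_add _ k (n + 1), Module.End.mul_apply, he, map_zero, smul_zero]

/-- Let `γ = β - pα` be the bottom of the string. Up to nonzero factors, `e ^ p` takes `e_γ` to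
`e_β` and `e ^ q` takes it to `e_{w_α β}`. Computing `f ^ p e ^ (p + q) e_γ` in two ways, through
`w_α⁻¹ e_γ` and through the `sl₂` formula, gives `(-1) ^ q (p + q)! A c = K B` with `K > 0`. As `c =
±1`, taking signs determines `c`. -/
theorem Ad_w_inv_e_eq (α β : H.root) :
    E.Ad (E.w α)⁻¹ (E.e β) = E.eta α β • E.e (reflRoot α β) := by
  by_cases hβ : β = α ∨ β = negRoot α
  · rw [eta, if_pos hβ]
    rcases hβ with rfl | rfl
    · rw [Ad_w_inv_e, reflRoot_self, neg_one_smul]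
    · rw [Ad_w_inv_e_neg, reflRoot_negRoot, reflRoot_self, negRoot_negRoot, neg_one_smul]
  rw [eta, if_neg hβ]
  rw [not_or] at hβ
  have hli := linearIndependent_root hβ.1 hβ.2
  obtain ⟨c, hc⟩ := E.exists_Ad_w_inv α β
  have hc2 := E.sq_eq_one_of_Ad_w_inv hc
  rw [hc]
  congr 1
  set p := (rootSystem H).chainBotCoeff α β with hp
  set q := (rootSystem H).chainTopCoeff α β with hq
  have hcomb : ∀ l : ℤ, -(p : ℤ) ≤ l → l ≤ q → IsRootComb l 1 α β := fun l h1 h2 =>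
    (isRootComb_one_iff hli l).2 ⟨h1, h2⟩
  have hγ := combRoot_spec (hcomb (-p) le_rfl (by omega))
  set γ := combRoot (-p) 1 α β with hγdef
  have hγli : LinearIndependent ℝ ![(rootSystem H).root α, (rootSystem H).root γ] := by
    have h1 : γ ≠ α ∧ γ ≠ negRoot α := by
      have key : ∀ s : ℤ, (rootSystem H).root γ ≠ s • (rootSystem H).root α := by
        intro s hs
        rw [hγ] at hs
        have := (LinearIndependent.pair_iff.1 hli (-(p : ℝ) - s) 1 (by
          rw [sub_smul, neg_smul, one_smul]
          have h2 : (-(p : ℤ)) • (rootSystem H).root α + (1 : ℤ) • (rootSystem H).root β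
            - s • (rootSystem H).root α = 0 := by rw [hs, sub_self]
          rw [← h2, one_smul, neg_smul, Int.cast_smul_eq_zsmul, natCast_zsmul,
            Nat.cast_smul_eq_nsmul]
          abel)).2
        norm_num at this
      refine ⟨fun h => key 1 (by rw [h, one_smul]), fun h => key (-1) (by
        rw [h, root_negRoot, neg_one_smul])⟩
    exact linearIndependent_root h1.1 h1.2
  have hγβ : ∀ l : ℤ, (l : ℤ) • (rootSystem H).root α + (1 : ℤ) • (rootSystem H).root γ =
      (l - p) • (rootSystem H).root α + (1 : ℤ) • (rootSystem H).root β := fun l => by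
    rw [hγ]; module
  have hcombγ : ∀ l : ℤ, IsRootComb l 1 α γ ↔ 0 ≤ l ∧ l ≤ p + q := fun l => by
    rw [isRootComb_iff_mem_range, hγβ, ← isRootComb_iff_mem_range, isRootComb_one_iff hli]
    omega
  have hcomb_eq : ∀ l : ℤ, 0 ≤ l → l ≤ p + q → combRoot l 1 α γ = combRoot (l - p) 1 α β :=
    fun l h1 h2 => combRoot_eq (by
      rw [combRoot_spec (hcomb _ (by omega) (by omega)), hγβ])
  have hβγ : combRoot p 1 α γ = β := combRoot_eq (by rw [hγβ]; simp)
  have hqγ : combRoot q 1 α γ = reflRoot α β := combRoot_eq (by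
    rw [hγβ, root_reflRoot, ← RootPairing.chainBotCoeff_sub_chainTopCoeff hli]
    module)
  have hA := E.ad_pow_e_eq hγli (k := p) ((hcombγ p).2 (by omega))
  have hB := E.ad_pow_e_eq hγli (k := q) ((hcombγ q).2 (by omega))
  rw [hβγ] at hA
  rw [hqγ] at hB
  have hn1 : ((ad ℝ L (E.e α)) ^ (p + q + 1)) (E.e γ) = 0 :=
    E.ad_pow_e_eq_zero hγli (by rw [hcombγ]; push_cast; omega)
  have hf : ⁅E.e (negRoot α), E.e γ⁆ = 0 := by
    refine eq_zero_of_not_isRootComb (a := -1) (b := 1) hγli (Or.inr one_ne_zero)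
      (χ := fun x => -α.1 x + γ.1 x) (by rw [hcombγ]; omega) (fun x => by simp)
      (E.lie_e_mem (E.e_mem γ) fun x => rfl)
  have hh : ⁅(coroot α.1 : L), E.e γ⁆ = -((p + q : ℕ) : ℝ) • E.e γ := by
    rw [lie_coe_e]
    congr 1
    have h1 := LinearMap.congr_fun hγ (coroot α.1)
    have h2 := congrArg (Int.cast : ℤ → ℝ) (RootPairing.chainBotCoeff_sub_chainTopCoeff hli)
    rw [pairingIn_cast] at h2
    simp only [LinearMap.add_apply, LinearMap.smul_apply, root_apply, root_apply_coroot_self,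
      ← h2, zsmul_eq_mul] at h1
    rw [h1]
    push_cast
    rw [← hp, ← hq]
    ring
  have h1 := E.ad_pow_eq_Ad_w_inv α (p + q) (E.e_ne_zero γ) hf hh hn1
  have h2 := E.Ad_w_inv_ad_pow α p (E.e γ)
  -- `e_γ` is a lowest weight vector, hence primitive for the triple with `e` and `f` exchanged.
  have Pγ : (E.isSl2Triple α).symm.HasPrimitiveVectorWith (E.e γ) ((p + q : ℕ) : ℝ) :=
    ⟨E.e_ne_zero γ, by rw [neg_lie, hh, neg_smul, neg_neg], hf⟩
  have h3 := lie_e_pow_lie_f_pow Pγ p (p + q) (by omega)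
  rw [Nat.add_sub_cancel_left, hB, h1, map_smul] at h3
  rw [hA, map_smul, hc] at h2
  set A := ∏ l ∈ Finset.range p, E.N α (combRoot l 1 α γ) with hAdef
  set B := ∏ l ∈ Finset.range q, E.N α (combRoot l 1 α γ) with hBdef
  set K := ∏ i ∈ Finset.range p, ((((p + q : ℕ) : ℝ) - i) * (((p + q : ℕ) : ℝ) - (p + q : ℕ) + i + 1))
  have hK : 0 < K := by
    refine Finset.prod_pos fun i hi => ?_
    have : i < p := Finset.mem_range.1 hi
    have h4 : (i : ℝ) < p := by exact_mod_cast this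
    have h5 : (0 : ℝ) ≤ q := by positivity
    have h6 : (0 : ℝ) ≤ i := by positivity
    push_cast
    refine mul_pos (by linarith) (by linarith)
  -- Otherwise `e ^ (p + q) e_γ` would vanish, although by `h1` it is a nonzero multiple of `w_α⁻¹
  -- e_γ`.
  have hA0 : A ≠ 0 := by
    intro hA0
    rw [hA0, zero_smul] at hA
    rw [add_comm, pow_add, Module.End.mul_apply, hA, map_zero, eq_comm, smul_eq_zero] at h1
    rcases h1 with h1 | h1
    · exact (mul_ne_zero (pow_ne_zero _ (by norm_num)) (by positivity)) h1
    · exact E.e_ne_zero γ (by rw [← E.Ad_Ad_inv (E.w α) (E.e γ), h1, map_zero])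
  have h4 : (((-1 : ℝ) ^ (p + q) * (p + q).factorial) * ((-1) ^ p * (A * c)) - K * B) •
      E.e (reflRoot α β) = 0 := by
    have h5 : ((ad ℝ L (E.e (negRoot α))) ^ p) (E.Ad (E.w α)⁻¹ (E.e γ)) =
        (-1 : ℝ) ^ p • A • c • E.e (reflRoot α β) := by
      rw [h2, smul_smul, ← mul_pow]; simp
    rw [h5] at h3
    rw [sub_smul, sub_eq_zero, mul_smul K, ← h3]
    simp only [smul_smul]
  have h5 := (smul_eq_zero.1 h4).resolve_right (E.e_ne_zero _)
  have h6 : (-1 : ℝ) ^ (p + q) * (-1) ^ p = (-1) ^ q := by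
    rw [pow_add, mul_right_comm, ← mul_pow]; simp
  have h7 : (-1 : ℝ) ^ q * (p + q).factorial * (A * c) = K * B := by
    rw [← h6]; linear_combination h5
  have h8 := congrArg rsign h7
  have h9 : rsign ((-1 : ℝ) ^ q) = (-1) ^ q := rsign_of_sq_eq_one (by rw [← pow_mul, mul_comm, pow_mul]; simp)
  have h10 : rsign ((p + q).factorial : ℝ) = 1 := by
    simp [rsign, Nat.factorial_pos]
  have h11 : rsign K = 1 := by simp [rsign, hK]
  rw [rsign_mul, rsign_mul, rsign_mul, rsign_mul, h9, h10, h11, rsign_of_sq_eq_one hc2] at h8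
  have hsA : ∏ l ∈ Finset.range p, E.chainSign α β ((l : ℤ) - p) = rsign A := by
    rw [hAdef, ← rsign_prod]
    refine Finset.prod_congr rfl fun l hl => ?_
    have := Finset.mem_range.1 hl
    rw [chainSign, hcomb_eq l (by omega) (by omega)]
  have hsB : ∏ l ∈ Finset.range q, E.chainSign α β ((l : ℤ) - p) = rsign B := by
    rw [hBdef, ← rsign_prod]
    refine Finset.prod_congr rfl fun l hl => ?_
    have := Finset.mem_range.1 hl
    rw [chainSign, hcomb_eq l (by omega) (by omega)]
  rw [hsA, hsB]
  have h12 := rsign_sq hA0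
  have h13 : (-1 : ℝ) ^ q * (-1) ^ q = 1 := by rw [← mul_pow]; simp
  calc c = ((-1 : ℝ) ^ q * (-1) ^ q) * (rsign A * rsign A) * c := by rw [h12, h13]; ring
    _ = (-1) ^ q * rsign A * ((-1) ^ q * 1 * (rsign A * c)) := by ring
    _ = (-1) ^ q * rsign A * rsign B := by rw [h8]; ring

theorem w_inv_conj_χ (α β : H.root) (x : ℝ) :
    (E.w α)⁻¹ * E.χ β x * E.w α = E.χ (reflRoot α β) (E.eta α β * x) := by
  have := E.conj_χ (E.w α)⁻¹ (E.Ad_w_inv_e_eq α β) x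
  rwa [inv_inv] at this

end ChevalleySystem

end Signs


/-! ### The elements `h_α(t)` -/

section ComplexRankOne

open NormedSpace

variable {m : ℕ} {h e f : Matrix (Fin m) (Fin m) ℂ}

theorem matrix_exp_mul_exp_neg (A : Matrix (Fin m) (Fin m) ℂ) : exp A * exp (-A) = 1 := by
  rw [← Matrix.exp_add_of_commute _ _ (Commute.neg_right (Commute.refl A)), add_neg_cancel,
    exp_zero]

theorem matrix_exp_neg_mul_exp (A : Matrix (Fin m) (Fin m) ℂ) : exp (-A) * exp A = 1 := by
  rw [← Matrix.exp_add_of_commute _ _ (Commute.neg_left (Commute.refl A)), neg_add_cancel,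
    exp_zero]

theorem exp_smul_mul_cartan (he : ⁅h, e⁆ = (2 : ℂ) • e) (z : ℂ) :
    exp (z • e) * h = (h - (2 * z) • e) * exp (z • e) := by
  have h1 : ⁅e, h⁆ = -((2 : ℂ) • e) := by rw [← lie_skew, he]
  have := matrix_exp_mul_eq_sum_mul_exp (z • e) h 2 (by simp [pow_two, h1])
  rw [this]
  congr 1
  simp [Finset.sum_range_succ, h1]
  module

theorem exp_smul_mul_opposite (hef : ⁅e, f⁆ = h) (he : ⁅h, e⁆ = (2 : ℂ) • e) (z : ℂ) :
    exp (z • e) * f = (f + z • h - z ^ 2 • e) * exp (z • e) := by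
  have h1 : ⁅e, h⁆ = -((2 : ℂ) • e) := by rw [← lie_skew, he]
  have := matrix_exp_mul_eq_sum_mul_exp (z • e) f 3 (by simp [pow_succ, h1, hef])
  rw [this]
  congr 1
  simp [Finset.sum_range_succ, h1, hef, pow_two]
  module

/-- Computed in the stages `h ↦ h - 2t e ↦ -h - 2t e ↦ -h`, one for each exponential from right to
left. It is used only for `t = 1`. -/
theorem weyl_mul_cartan (hef : ⁅e, f⁆ = h) (he : ⁅h, e⁆ = (2 : ℂ) • e) (hf : ⁅h, f⁆ = -((2 : ℂ) • f))
    {t : ℂ} (ht : t ≠ 0) :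
    exp (t • e) * exp ((-t⁻¹) • f) * exp (t • e) * h =
      -h * (exp (t • e) * exp ((-t⁻¹) • f) * exp (t • e)) := by
  have hf' : ⁅-h, f⁆ = (2 : ℂ) • f := by rw [neg_lie, hf, neg_neg]
  have hfe : ⁅f, e⁆ = -h := by rw [← lie_skew, hef]
  have h1 := exp_smul_mul_cartan he t
  have h2 := exp_smul_mul_cartan hf' (-t⁻¹)
  have h3 := exp_smul_mul_opposite hfe hf' (-t⁻¹)
  have h4 : exp ((-t⁻¹) • f) * (h - (2 * t) • e) = (-h - (2 * t) • e) * exp ((-t⁻¹) • f) := by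
    have h5 : h - (2 * t) • e = -(-h) - (2 * t) • e := by rw [neg_neg]
    rw [h5, mul_sub, mul_neg, h2, mul_smul_comm, h3, ← neg_mul, ← smul_mul_assoc, ← sub_mul]
    congr 1
    simp only [smul_add, smul_sub, smul_neg, smul_smul]
    have e1 : 2 * t * -t⁻¹ = -2 := by field_simp
    have e2 : 2 * t * (-t⁻¹) ^ 2 = -(2 * -t⁻¹) := by field_simp
    rw [e1, e2]
    module
  have h6 : exp (t • e) * (-h - (2 * t) • e) = -h * exp (t • e) := by
    have h7 : exp (t • e) * e = e * exp (t • e) :=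
      (((Commute.refl e).smul_left t).exp_left).eq
    rw [mul_sub, mul_neg, h1, mul_smul_comm, h7, ← neg_mul, ← smul_mul_assoc, ← sub_mul]
    congr 1
    abel
  rw [mul_assoc, h1, ← mul_assoc, mul_assoc (exp (t • e)), h4, ← mul_assoc, h6]
  simp only [mul_assoc]

/-- Conjugation by `exp((u/2) h)` scales `e` by `e^u` and `f` by `e^{-u}`, so it turns the Weyl
element `W` of parameter `1` into that of parameter `e^u`. As `W` inverts the torus, the two half
factors combine to `exp(-u h)` on the right of `W`. -/
theorem weyl_exp_eq (hef : ⁅e, f⁆ = h) (he : ⁅h, e⁆ = (2 : ℂ) • e) (hf : ⁅h, f⁆ = -((2 : ℂ) • f))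
    (u : ℂ) :
    exp (Complex.exp u • e) * exp ((-(Complex.exp u)⁻¹) • f) * exp (Complex.exp u • e) =
      exp ((1 : ℂ) • e) * exp ((-(1 : ℂ)⁻¹) • f) * exp ((1 : ℂ) • e) * exp (-u • h) := by
  have he' : ∀ x : ℂ, exp ((u / 2) • h) * exp (x • e) =
      exp ((Complex.exp u * x) • e) * exp ((u / 2) • h) := fun x => by
    refine matrix_mul_exp_of_mul_eq _ _ _ ?_
    have := matrix_exp_mul_of_lie_eq_smul (A := (u / 2) • h) (B := e) (c := u) (by
      rw [smul_mul_assoc, mul_smul_comm, ← smul_sub, ← LieRing.of_associative_ring_bracket, he,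
        smul_smul]
      congr 1; ring)
    rw [mul_smul_comm, this, smul_smul, ← smul_mul_assoc, mul_comm x]
  have hf' : ∀ x : ℂ, exp ((u / 2) • h) * exp (x • f) =
      exp (((Complex.exp u)⁻¹ * x) • f) * exp ((u / 2) • h) := fun x => by
    refine matrix_mul_exp_of_mul_eq _ _ _ ?_
    have := matrix_exp_mul_of_lie_eq_smul (A := (u / 2) • h) (B := f) (c := -u) (by
      rw [smul_mul_assoc, mul_smul_comm, ← smul_sub, ← LieRing.of_associative_ring_bracket, hf,
        ← neg_smul, smul_smul]
      congr 1; ring)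
    rw [mul_smul_comm, this, smul_smul, ← Complex.exp_neg, mul_comm x, ← smul_mul_assoc]
  have hw := weyl_mul_cartan hef he hf one_ne_zero
  set W := exp ((1 : ℂ) • e) * exp ((-(1 : ℂ)⁻¹) • f) * exp ((1 : ℂ) • e) with hW
  have h1 : exp ((u / 2) • h) * W = exp (Complex.exp u • e) * exp ((-(Complex.exp u)⁻¹) • f) *
      exp (Complex.exp u • e) * exp ((u / 2) • h) := by
    rw [hW, ← mul_assoc, ← mul_assoc, he', mul_assoc (exp _) (exp ((u / 2) • h)), hf',
      ← mul_assoc, mul_assoc _ (exp ((u / 2) • h)), he', ← mul_assoc]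
    simp
  have h2 : W * exp (-((u / 2) • h)) = exp ((u / 2) • h) * W := by
    refine matrix_mul_exp_of_mul_eq _ _ _ ?_
    rw [mul_neg, mul_smul_comm, hw, neg_mul, smul_neg, neg_neg, smul_mul_assoc]
  have h3 := matrix_exp_mul_exp_neg ((u / 2) • h)
  have h4 : exp (-u • h) = exp (-((u / 2) • h)) * exp (-((u / 2) • h)) := by
    rw [← Matrix.exp_add_of_commute _ _ (Commute.refl _)]
    congr 1
    module
  rw [h4, ← mul_assoc, h2, h1]
  exact ((mul_assoc _ _ _).trans (by rw [h3, mul_one])).symm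

end ComplexRankOne

/-! ### Torus relations, checked in all complexified representations. -/

section Torus

variable {L : Type*} [LieRing L] [LieAlgebra ℝ L]

/-- The matrix of a real representation, regarded as a complex matrix. -/
def cMat (ρ : MatRep L) (X : L) : Matrix (Fin ρ.1) (Fin ρ.1) ℂ :=
  Complex.ofRealHom.mapMatrix (ρ.2 X)

/-- The value of a group element in a representation, regarded as a complex matrix. -/
def cVal (ρ : MatRep L) (g : AllGL L) : Matrix (Fin ρ.1) (Fin ρ.1) ℂ :=
  Complex.ofRealHom.mapMatrix (g ρ : Matrix (Fin ρ.1) (Fin ρ.1) ℝ)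

theorem cVal_mul (ρ : MatRep L) (g g' : AllGL L) : cVal ρ (g * g') = cVal ρ g * cVal ρ g' := by
  rw [cVal, Pi.mul_apply, Units.val_mul, map_mul]; rfl

theorem cVal_one (ρ : MatRep L) : cVal ρ 1 = 1 := by
  rw [cVal, Pi.one_apply, Units.val_one, map_one]

theorem ofReal_mapMatrix_injective (m : ℕ) : Function.Injective
    (Complex.ofRealHom.mapMatrix : Matrix (Fin m) (Fin m) ℝ → Matrix (Fin m) (Fin m) ℂ) :=
  Matrix.map_injective Complex.ofReal_injective

theorem eq_of_cVal_eq {g g' : AllGL L} (h : ∀ ρ, cVal ρ g = cVal ρ g') : g = g' :=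
  funext fun ρ => Units.ext (ofReal_mapMatrix_injective _ (h ρ))

theorem cMat_smul (ρ : MatRep L) (x : ℝ) (X : L) : cMat ρ (x • X) = (x : ℂ) • cMat ρ X := by
  ext i j; simp [cMat]

theorem cMat_neg (ρ : MatRep L) (X : L) : cMat ρ (-X) = -cMat ρ X := by
  rw [cMat, map_neg, map_neg]; rfl

theorem cMat_lie (ρ : MatRep L) (X Y : L) : cMat ρ ⁅X, Y⁆ = ⁅cMat ρ X, cMat ρ Y⁆ := by
  rw [cMat, LieHom.map_lie, LieRing.of_associative_ring_bracket, map_sub, map_mul, map_mul]; rfl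

theorem cVal_expAll (ρ : MatRep L) (X : L) :
    cVal ρ (expAll X) = NormedSpace.exp (cMat ρ X) := matrix_exp_map_ofReal (ρ.2 X)

variable [FiniteDimensional ℝ L] [IsKilling ℝ L]
  {H : LieSubalgebra ℝ L} [H.IsCartanSubalgebra] [LieModule.IsTriangularizable ℝ H L]
  (E : ChevalleySystem H)

namespace ChevalleySystem

theorem cVal_χ (ρ : MatRep L) (α : H.root) (x : ℝ) :
    cVal ρ (E.χ α x : AllGL L) = NormedSpace.exp ((x : ℂ) • cMat ρ (E.e α)) := by
  rw [← cMat_smul]; exact cVal_expAll ρ _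

theorem eq_of_forall_cVal_eq {g g' : E.G} (h : ∀ ρ, cVal ρ (g : AllGL L) = cVal ρ (g' : AllGL L)) :
    g = g' := Subtype.ext (eq_of_cVal_eq h)

/-- For `t = e^u` with `u` complex, `h_α(t)` acts as `exp (-u α^∨)`. -/
theorem cVal_h (ρ : MatRep L) (α : H.root) {t : ℝ} {u : ℂ} (hu : Complex.exp u = t) :
    cVal ρ (E.h α t : AllGL L) = NormedSpace.exp (-u • cMat ρ (coroot α.1 : L)) := by
  have hef : ⁅cMat ρ (E.e α), cMat ρ (E.e (negRoot α))⁆ = cMat ρ (coroot α.1 : L) := by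
    rw [← cMat_lie, E.lie_e_neg]
  have he : ⁅cMat ρ (coroot α.1 : L), cMat ρ (E.e α)⁆ = (2 : ℂ) • cMat ρ (E.e α) := by
    rw [← cMat_lie, (E.isSl2Triple α).lie_h_e_smul ℝ, cMat_smul]; norm_num
  have hf : ⁅cMat ρ (coroot α.1 : L), cMat ρ (E.e (negRoot α))⁆ =
      -((2 : ℂ) • cMat ρ (E.e (negRoot α))) := by
    rw [← cMat_lie, (E.isSl2Triple α).lie_lie_smul_f ℝ, cMat_neg, cMat_smul]; norm_num
  have h1 := weyl_exp_eq hef he hf u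
  rw [hu] at h1
  have h2 : ∀ s : ℝ, cVal ρ (E.wt α s : AllGL L) =
      NormedSpace.exp ((s : ℂ) • cMat ρ (E.e α)) *
        NormedSpace.exp ((-(s : ℂ)⁻¹) • cMat ρ (E.e (negRoot α))) *
        NormedSpace.exp ((s : ℂ) • cMat ρ (E.e α)) := fun s => by
    rw [wt, Subgroup.coe_mul, Subgroup.coe_mul, cVal_mul, cVal_mul, cVal_χ, cVal_χ]
    push_cast; rfl
  have h3 := h2 1
  rw [Complex.ofReal_one] at h3
  rw [← h2, ← h3] at h1
  rw [h, Subgroup.coe_mul, cVal_mul, h1, ← mul_assoc, ← cVal_mul, ← Subgroup.coe_mul, w,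
    inv_mul_cancel, Subgroup.coe_one, cVal_one, one_mul]

theorem exists_exp_eq {t : ℝ} (ht : t ≠ 0) : ∃ u : ℂ, Complex.exp u = t :=
  ⟨Complex.log t, Complex.exp_log (by exact_mod_cast ht)⟩

theorem h_one (α : H.root) : E.h α 1 = 1 := by rw [h, w, inv_mul_cancel]

theorem h_mul_h (α : H.root) {s t : ℝ} (hs : s ≠ 0) (ht : t ≠ 0) :
    E.h α s * E.h α t = E.h α (s * t) := by
  obtain ⟨u, hu⟩ := exists_exp_eq hs
  obtain ⟨v, hv⟩ := exists_exp_eq ht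
  refine E.eq_of_forall_cVal_eq fun ρ => ?_
  rw [Subgroup.coe_mul, cVal_mul, E.cVal_h ρ α hu, E.cVal_h ρ α hv,
    E.cVal_h ρ α (u := u + v) (by rw [Complex.exp_add, hu, hv]; push_cast; rfl),
    ← Matrix.exp_add_of_commute _ _ (((Commute.refl _).smul_left _).smul_right _)]
  congr 1
  module

theorem h_inv (α : H.root) {t : ℝ} (ht : t ≠ 0) : (E.h α t)⁻¹ = E.h α t⁻¹ := by
  rw [inv_eq_iff_mul_eq_one, h_mul_h _ _ ht (inv_ne_zero ht), mul_inv_cancel₀ ht, h_one]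

theorem h_commute (α β : H.root) {s t : ℝ} (hs : s ≠ 0) (ht : t ≠ 0) :
    Commute (E.h α s) (E.h β t) := by
  obtain ⟨u, hu⟩ := exists_exp_eq hs
  obtain ⟨v, hv⟩ := exists_exp_eq ht
  refine E.eq_of_forall_cVal_eq fun ρ => ?_
  have h1 : ⁅(coroot α.1 : L), (coroot β.1 : L)⁆ = 0 := by
    rw [← LieSubalgebra.coe_bracket, LieModule.IsTrivial.trivial]; rfl
  have h2 : Commute (cMat ρ (coroot α.1 : L)) (cMat ρ (coroot β.1 : L)) := by
    rw [commute_iff_lie_eq, ← cMat_lie, h1, cMat, map_zero, map_zero]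
  rw [Subgroup.coe_mul, cVal_mul, Subgroup.coe_mul, cVal_mul, E.cVal_h ρ α hu, E.cVal_h ρ β hv]
  exact ((h2.smul_left _).smul_right _).exp

theorem h_mul_χ (α β : H.root) {t : ℝ} (ht : t ≠ 0) (x : ℝ) :
    E.h α t * E.χ β x =
      E.χ β (t ^ (-(rootSystem H).pairingIn ℤ β α) * x) * E.h α t := by
  obtain ⟨u, hu⟩ := exists_exp_eq ht
  refine E.eq_of_forall_cVal_eq fun ρ => ?_
  rw [Subgroup.coe_mul, cVal_mul, Subgroup.coe_mul, cVal_mul, E.cVal_h ρ α hu, cVal_χ, cVal_χ]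
  refine matrix_mul_exp_of_mul_eq _ _ _ ?_
  have h1 := matrix_exp_mul_of_lie_eq_smul (A := -u • cMat ρ (coroot α.1 : L))
    (B := cMat ρ (E.e β)) (c := (-(rootSystem H).pairingIn ℤ β α : ℤ) * u) (by
      rw [smul_mul_assoc, mul_smul_comm, ← smul_sub, ← LieRing.of_associative_ring_bracket,
        ← cMat_lie, E.lie_coe_e, cMat_smul, ← pairingIn_cast, smul_smul]
      congr 1; push_cast; ring)
  rw [mul_smul_comm, h1, Complex.exp_int_mul, hu, smul_smul, ← smul_mul_assoc]
  push_cast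
  rw [mul_comm]

theorem θ_h (α : H.root) {t : ℝ} (ht : t ≠ 0) : E.θ (E.h α t) = (E.h α t)⁻¹ := by
  rw [eq_inv_iff_mul_eq_one]
  obtain ⟨u, hu⟩ := exists_exp_eq ht
  refine E.eq_of_forall_cVal_eq fun ρ => ?_
  -- The value of `θ(g)` in `ρ` is the value of `g` in `ρ` composed with the involution, which
  -- negates coroots.
  have h1 : cVal ρ (E.θ (E.h α t) : AllGL L) =
    NormedSpace.exp (-u • cMat ⟨ρ.1, ρ.2.comp (E.invol : L →ₗ⁅ℝ⁆ L)⟩ (coroot α.1 : L)) :=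
    E.cVal_h ⟨ρ.1, ρ.2.comp (E.invol : L →ₗ⁅ℝ⁆ L)⟩ α hu
  have h2 : cMat ⟨ρ.1, ρ.2.comp (E.invol : L →ₗ⁅ℝ⁆ L)⟩ (coroot α.1 : L) =
      -cMat ρ (coroot α.1 : L) := by
    have h3 : E.invol (coroot α.1 : L) = -(coroot α.1 : L) := by
      rw [← E.lie_e_neg, LieEquiv.map_lie, E.invol_e, E.invol_e, negRoot_negRoot, neg_lie, lie_neg,
        neg_neg, lie_skew]
    change cMat ρ (E.invol (coroot α.1 : L)) = _
    rw [h3, cMat_neg]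
  rw [Subgroup.coe_mul, cVal_mul, h1, h2, E.cVal_h ρ α hu, Subgroup.coe_one, cVal_one, smul_neg,
    matrix_exp_neg_mul_exp]

theorem w_mul_w (α : H.root) : E.w α * E.w α = E.h α (-1) := by
  -- Because `w_α(-1) = w_α⁻¹`, factor by factor.
  have h1 : E.h α (-1) = (E.w α * E.w α)⁻¹ := by
    rw [mul_inv_rev, h]
    congr 1
    rw [w, wt, wt, χ_neg, χ_neg]
    simp [χ_neg, mul_assoc]
  rw [← inv_inv (E.w α * E.w α), ← h1, h_inv _ _ (by norm_num)]
  norm_num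

theorem wt_eq (α : H.root) (t : ℝ) : E.wt α t = E.w α * E.h α t := by
  rw [h, mul_inv_cancel_left]

end ChevalleySystem

end Torus


/-! ### The elements `κ_α(x)` -/

section Kappa

variable {L : Type*} [LieRing L] [LieAlgebra ℝ L] [FiniteDimensional ℝ L] [IsKilling ℝ L]
  {H : LieSubalgebra ℝ L} [H.IsCartanSubalgebra] [LieModule.IsTriangularizable ℝ H L]
  (E : ChevalleySystem H)

namespace ChevalleySystem

theorem pairingIn_negRoot_self (α : H.root) :
    (rootSystem H).pairingIn ℤ (negRoot α) α = -2 := by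
  have h := pairingIn_cast α (negRoot α)
  have h1 : (negRoot α).1 (coroot α.1) = -2 := by
    rw [← root_apply_coroot_self α]; rfl
  rw [h1] at h
  exact_mod_cast h

theorem h_mul_χ_self (α : H.root) {t : ℝ} (ht : t ≠ 0) (x : ℝ) :
    E.h α t * E.χ α x = E.χ α ((t ^ 2)⁻¹ * x) * E.h α t := by
  rw [E.h_mul_χ α α ht, RootPairing.pairingIn_same]
  rfl

theorem h_mul_χ_neg (α : H.root) {t : ℝ} (ht : t ≠ 0) (x : ℝ) :
    E.h α t * E.χ (negRoot α) x = E.χ (negRoot α) (t ^ 2 * x) * E.h α t := by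
  rw [E.h_mul_χ α _ ht, pairingIn_negRoot_self]
  rfl

theorem w_mul_χ (α : H.root) (x : ℝ) : E.w α * E.χ α x = E.χ (negRoot α) (-x) * E.w α := by
  rw [← w_conj_χ, inv_mul_cancel_right]

theorem w_mul_χ_neg (α : H.root) (x : ℝ) : E.w α * E.χ (negRoot α) x = E.χ α (-x) * E.w α := by
  rw [← w_conj_χ_neg, inv_mul_cancel_right]

/-- The definition of `w_α(-y⁻¹)`, solved for its middle factor. For `y = 0` it also holds, since
`0⁻¹ = 0` and both sides are trivial. -/
theorem χ_neg_eq (α : H.root) (y : ℝ) :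
    E.χ (negRoot α) y = E.χ α y⁻¹ * (E.w α * E.h α (-y⁻¹)) * E.χ α y⁻¹ := by
  rw [← wt_eq, wt, inv_neg, inv_inv, neg_neg, χ_neg]
  group

/-- A factorization in `SL₂`, to which `κ ∈ K` reduces. Expanding both factors from `χ_{-α}` by
`χ_neg_eq` puts the two sides in Bruhat form, where parameters are compared. The case `x = 0` is
separate because of the division. -/
theorem χ_mul_χ_neg_mul_χ (α : H.root) (x : ℝ) :
    E.χ α x * E.χ (negRoot α) x * E.χ α (-(x / (x ^ 2 + 1))) =
      E.χ (negRoot α) (x / (x ^ 2 + 1)) * E.h α (x ^ 2 + 1)⁻¹ := by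
  rcases eq_or_ne x 0 with rfl | hx
  · simp [χ_zero, h_one]
  have hρ : x ^ 2 + 1 ≠ 0 := by positivity
  set ρ := x ^ 2 + 1 with hρdef
  have h1 : E.χ α (x / ρ)⁻¹ * E.h α ρ⁻¹ = E.h α ρ⁻¹ * E.χ α (x * ρ)⁻¹ := by
    rw [E.h_mul_χ_self _ (inv_ne_zero hρ)]
    congr 2
    field_simp
  rw [E.χ_neg_eq α x, E.χ_neg_eq α (x / ρ), mul_assoc _ _ (E.h α ρ⁻¹), h1,
    ← mul_assoc, ← mul_assoc, ← χ_add, mul_assoc _ (E.χ α _) (E.χ α _), ← χ_add,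
    ← mul_assoc _ (E.h α ρ⁻¹), mul_assoc _ _ (E.h α ρ⁻¹), mul_assoc (E.w α),
    E.h_mul_h α (neg_ne_zero.2 (inv_ne_zero (div_ne_zero hx hρ))) (inv_ne_zero hρ)]
  have e1 : x + x⁻¹ = (x / ρ)⁻¹ := by rw [hρdef]; field_simp
  have e2 : x⁻¹ + -(x / ρ) = (x * ρ)⁻¹ := by rw [hρdef]; field_simp; ring
  have e3 : -(x / ρ)⁻¹ * ρ⁻¹ = -x⁻¹ := by field_simp
  rw [e1, e2, e3]

/-- After `w_α` is moved to the right end of both `κ` and `θ(κ)` it cancels. Moving the torus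
factors next to it leaves the preceding `SL₂` identity, with `1 / r ^ 2 = 1 / (x ^ 2 + 1)`. -/
theorem κ_mem_K (α : H.root) (x : ℝ) : E.κ α x ∈ E.K := by
  change E.θ (E.κ α x) = E.κ α x
  have hpos : 0 < x ^ 2 + 1 := by positivity
  have hr0 : √(x ^ 2 + 1) ≠ 0 := (Real.sqrt_pos.2 hpos).ne'
  have hr2 : √(x ^ 2 + 1) ^ 2 = x ^ 2 + 1 := Real.sq_sqrt hpos.le
  set r := √(x ^ 2 + 1) with hr
  have hr' : -1 / r ≠ 0 := div_ne_zero (by norm_num) hr0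
  have key := E.χ_mul_χ_neg_mul_χ α x
  rw [κ, ← hr, map_mul, map_mul, map_mul, θ_w, θ_χ, E.θ_h α hr', h_inv _ _ hr', neg_neg,
    mul_assoc _ (E.w α), w_mul_χ_neg, ← mul_assoc, mul_assoc _ (E.h α _) (E.χ α (-x)),
    E.h_mul_χ_self α (inv_ne_zero hr'), mul_assoc _ (E.w α), w_mul_χ, neg_neg,
    ← mul_assoc (E.χ α (-x) * _), mul_assoc _ (E.h α _) (E.χ (negRoot α) _),
    E.h_mul_χ_neg α hr', ← mul_assoc]
  congr 1
  have e1 : (((-1 / r)⁻¹) ^ 2)⁻¹ * -x = -(x / (x ^ 2 + 1)) := by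
    rw [← hr2]; field_simp
  have e2 : (-1 / r) ^ 2 * x = x / (x ^ 2 + 1) := by
    rw [← hr2]; field_simp
  have e3 : E.h α (-1 / r) = E.h α (x ^ 2 + 1)⁻¹ * E.h α (-1 / r)⁻¹ := by
    rw [E.h_mul_h α (inv_ne_zero hpos.ne') (inv_ne_zero hr'), ← hr2]
    congr 1
    field_simp
  rw [e1, e2, e3, ← mul_assoc (E.χ (negRoot α) (x / (x ^ 2 + 1))), ← key,
    E.χ_neg α x]
  group

end ChevalleySystem

end Kappa


/-! ### The commutator relation for two simple roots -/

section NilpotentExp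

variable {L : Type*} [LieRing L] [LieAlgebra ℝ L]

/-- The Lie brackets between the elements of a chain `v, [T, v], [T, [T, v]], …` of length at most
four in which the first two elements commute. -/
theorem lie_chain {T v v1 v2 v3 : L} (h1 : ⁅T, v⁆ = v1) (h2 : ⁅T, v1⁆ = v2) (h3 : ⁅T, v2⁆ = v3)
    (h4 : ⁅T, v3⁆ = 0) (h01 : ⁅v, v1⁆ = 0) :
    ⁅v, v2⁆ = 0 ∧ ⁅v, v3⁆ = -⁅v1, v2⁆ ∧ ⁅v1, v3⁆ = 0 ∧ ⁅v2, v3⁆ = 0 ∧ ⁅v, ⁅v1, v2⁆⁆ = 0 ∧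
      ⁅v1, ⁅v1, v2⁆⁆ = 0 ∧ ⁅v2, ⁅v1, v2⁆⁆ = 0 ∧ ⁅v3, ⁅v1, v2⁆⁆ = 0 := by
  have h02 : ⁅v, v2⁆ = 0 := by
    have := leibniz_lie T v v1
    rw [h01, h1, h2, lie_self, zero_add, lie_zero] at this
    exact this.symm
  have h03 : ⁅v, v3⁆ = -⁅v1, v2⁆ := by
    have := leibniz_lie T v v2
    rw [h02, h1, h3, lie_zero] at this
    exact (neg_eq_of_add_eq_zero_right this.symm).symm
  have hT : ⁅T, ⁅v1, v2⁆⁆ = ⁅v1, v3⁆ := by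
    rw [leibniz_lie, h2, h3, lie_self, zero_add]
  have h13 : ⁅v1, v3⁆ = 0 := by
    have := leibniz_lie T v v3
    rw [h03, lie_neg, hT, h1, h4, lie_zero, add_zero] at this
    -- Applying `ad T` to `⁅v, v3⁆ = -⁅v1, v2⁆` shows that `⁅v1, v3⁆` equals its own negative.
    have h2 : (2 : ℝ) • ⁅v1, v3⁆ = 0 := by
      nth_rewrite 1 [two_smul, ← this]
      exact neg_add_cancel _
    exact (smul_eq_zero.1 h2).resolve_left two_ne_zero
  have h23 : ⁅v2, v3⁆ = 0 := by
    have := leibniz_lie T v1 v3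
    rw [h13, lie_zero, h2, h4, lie_zero, add_zero] at this
    exact this.symm
  rw [h13] at hT
  have z0 : ⁅v, ⁅v1, v2⁆⁆ = 0 := by rw [leibniz_lie, h01, h02, zero_lie, lie_zero, add_zero]
  have step : ∀ a b : L, ⁅T, a⁆ = b → ⁅a, ⁅v1, v2⁆⁆ = 0 → ⁅b, ⁅v1, v2⁆⁆ = 0 := by
    intro a b hab ha
    rw [← hab, lie_lie, hT, ha, lie_zero, lie_zero, sub_zero]
  exact ⟨h02, h03, h13, h23, z0, step _ _ h1 z0, step _ _ h2 (step _ _ h1 z0),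
    step _ _ h3 (step _ _ h2 (step _ _ h1 z0))⟩

theorem expAll_zero : expAll (0 : L) = 1 := by
  refine funext fun ρ => Units.ext ?_
  change NormedSpace.exp (ρ.2 0) = 1
  rw [map_zero, NormedSpace.exp_zero]

theorem expAll_add_of_lie_lie_eq_zero {A B : L} (hA : ⁅A, ⁅A, B⁆⁆ = 0) (hB : ⁅B, ⁅A, B⁆⁆ = 0) :
    expAll (A + B) = expAll A * expAll B * expAll (-((1 / 2 : ℝ) • ⁅A, B⁆)) := by
  refine funext fun ρ => Units.ext ?_
  change NormedSpace.exp (ρ.2 (A + B)) = NormedSpace.exp (ρ.2 A) * NormedSpace.exp (ρ.2 B) *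
    NormedSpace.exp (ρ.2 (-((1 / 2 : ℝ) • ⁅A, B⁆)))
  rw [map_add, map_neg, map_smul, LieHom.map_lie]
  refine matrix_exp_add_of_commute_lie _ _ ?_ ?_
  · rw [← LieHom.map_lie, ← LieHom.map_lie, hA, map_zero]
  · rw [← LieHom.map_lie, ← LieHom.map_lie, hB, map_zero]

theorem expAll_add_of_lie_eq_zero {A B : L} (h : ⁅A, B⁆ = 0) :
    expAll (A + B) = expAll A * expAll B := by
  rw [expAll_add_of_lie_lie_eq_zero (by rw [h, lie_zero]) (by rw [h, lie_zero]), h, smul_zero,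
    neg_zero, expAll_zero, mul_one]

theorem expAll_commute {A B : L} (h : ⁅A, B⁆ = 0) : Commute (expAll A) (expAll B) := by
  have h' : ⁅B, A⁆ = 0 := by rw [← lie_skew, h, neg_zero]
  change expAll A * expAll B = expAll B * expAll A
  rw [← expAll_add_of_lie_eq_zero h, ← expAll_add_of_lie_eq_zero h', add_comm]

/-- The only bracket that survives, `⁅v1, v2⁆`, is central here, so one second-order correction is
exact. -/
theorem expAll_chain {v1 v2 v3 : L} (h13 : ⁅v1, v3⁆ = 0) (h23 : ⁅v2, v3⁆ = 0)
    (z1 : ⁅v1, ⁅v1, v2⁆⁆ = 0) (z2 : ⁅v2, ⁅v1, v2⁆⁆ = 0) (z3 : ⁅v3, ⁅v1, v2⁆⁆ = 0) (a b c : ℝ) :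
    expAll (a • v1 + (b • v2 + c • v3)) = expAll (a • v1) * expAll (b • v2) * expAll (c • v3) *
      expAll ((-(1 / 2) * a * b) • ⁅v1, v2⁆) := by
  have hb : ⁅a • v1, b • v2 + c • v3⁆ = (a * b) • ⁅v1, v2⁆ := by
    simp [h13, smul_smul, mul_comm]
  rw [expAll_add_of_lie_lie_eq_zero, expAll_add_of_lie_eq_zero, hb, ← mul_assoc]
  · congr 2
    module
  · simp [h23]
  · rw [hb]; simp [z1]
  · rw [hb]; simp [z2, z3]

/-- The left side is a conjugate of `exp(xX)`, with `X1, X2, X3` the iterated brackets. The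
coefficient `1/6` is `1/4 - 1/12`: the correction for `X1, X2`, and the one for splitting off `X`.
-/
theorem expAll_commutator_left {X X1 X2 X3 : L}
    (h01 : ⁅X, X1⁆ = 0) (h02 : ⁅X, X2⁆ = 0) (h03 : ⁅X, X3⁆ = -⁅X1, X2⁆) (h13 : ⁅X1, X3⁆ = 0)
    (h23 : ⁅X2, X3⁆ = 0) (z0 : ⁅X, ⁅X1, X2⁆⁆ = 0) (z1 : ⁅X1, ⁅X1, X2⁆⁆ = 0)
    (z2 : ⁅X2, ⁅X1, X2⁆⁆ = 0) (z3 : ⁅X3, ⁅X1, X2⁆⁆ = 0) (x y : ℝ) :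
    expAll (x • (X + (-y) • X1 + (2⁻¹ * (-y) ^ 2) • X2 + (6⁻¹ * (-y) ^ 3) • X3)) =
      expAll (x • X) * (expAll ((x * y) • -X1) * expAll ((x * y ^ 2) • (2 : ℝ)⁻¹ • X2) *
        expAll ((x * y ^ 3) • -((6 : ℝ)⁻¹ • X3)) *
        expAll ((x ^ 2 * y ^ 3) • (6 : ℝ)⁻¹ • ⁅X1, X2⁆)) := by
  have h1 : x • (X + (-y) • X1 + (2⁻¹ * (-y) ^ 2) • X2 + (6⁻¹ * (-y) ^ 3) • X3) =
      x • X + ((-(x * y)) • X1 + ((x * y ^ 2 / 2) • X2 + (-(x * y ^ 3) / 6) • X3)) := by module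
  have hb : ⁅x • X, (-(x * y)) • X1 + ((x * y ^ 2 / 2) • X2 + (-(x * y ^ 3) / 6) • X3)⁆ =
      (x ^ 2 * y ^ 3 / 6) • ⁅X1, X2⁆ := by
    simp only [lie_add, lie_smul, smul_lie, h01, h02, h03]; module
  rw [h1, expAll_add_of_lie_lie_eq_zero, hb, expAll_chain h13 h23 z1 z2 z3]
  · simp only [mul_assoc]
    rw [← expAll_add_of_lie_eq_zero (by simp)]
    congr 2
    · congr 1; module
    congr 1
    · congr 1; module
    congr 1
    · congr 1; module
    · congr 1; module
  · rw [hb]; simp [z0]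
  · rw [hb]; simp [z1, z2, z3]

/-- The mirror case, with the long string on the other root. Here the two corrections add up, `1/4 +
1/12 = 1/3`, whence the asymmetry between `C_32` and `C_23`. -/
theorem expAll_commutator_right {Y Y1 Y2 Y3 : L}
    (h01 : ⁅Y, Y1⁆ = 0) (h02 : ⁅Y, Y2⁆ = 0) (h03 : ⁅Y, Y3⁆ = -⁅Y1, Y2⁆) (h13 : ⁅Y1, Y3⁆ = 0)
    (h23 : ⁅Y2, Y3⁆ = 0) (z0 : ⁅Y, ⁅Y1, Y2⁆⁆ = 0) (z1 : ⁅Y1, ⁅Y1, Y2⁆⁆ = 0)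
    (z2 : ⁅Y2, ⁅Y1, Y2⁆⁆ = 0) (z3 : ⁅Y3, ⁅Y1, Y2⁆⁆ = 0) (x y : ℝ) :
    expAll ((-y) • (Y + (-x) • Y1 + (2⁻¹ * (-x) ^ 2) • Y2 + (6⁻¹ * (-x) ^ 3) • Y3)) *
        expAll (y • Y) =
      expAll ((x * y) • Y1) * expAll ((x ^ 2 * y) • -((2 : ℝ)⁻¹ • Y2)) *
        expAll ((x ^ 3 * y) • (6 : ℝ)⁻¹ • Y3) *
        expAll ((x ^ 3 * y ^ 2) • (3 : ℝ)⁻¹ • ⁅Y1, Y2⁆) := by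
  have h1 : (-y) • (Y + (-x) • Y1 + (2⁻¹ * (-x) ^ 2) • Y2 + (6⁻¹ * (-x) ^ 3) • Y3) =
      ((x * y) • Y1 + ((-(x ^ 2 * y) / 2) • Y2 + (x ^ 3 * y / 6) • Y3)) + (-y) • Y := by module
  have hb : ⁅(x * y) • Y1 + ((-(x ^ 2 * y) / 2) • Y2 + (x ^ 3 * y / 6) • Y3), (-y) • Y⁆ =
      (-(x ^ 3 * y ^ 2) / 6) • ⁅Y1, Y2⁆ := by
    rw [← lie_skew]
    simp only [lie_add, lie_smul, smul_lie, h01, h02, h03]; module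
  have hc : Commute (expAll (-((1 / 2 : ℝ) • (-(x ^ 3 * y ^ 2) / 6) • ⁅Y1, Y2⁆)))
      (expAll (y • Y)) := expAll_commute (by
    rw [← lie_skew]; simp [z0])
  have hY : expAll ((-y) • Y) * expAll (y • Y) = 1 := by
    rw [← expAll_add_of_lie_eq_zero (by simp), ← add_smul, neg_add_cancel, zero_smul, expAll_zero]
  have hZ : expAll ((-(1 / 2) * (x * y) * (-(x ^ 2 * y) / 2)) • ⁅Y1, Y2⁆) *
      expAll (-((1 / 2 : ℝ) • (-(x ^ 3 * y ^ 2) / 6) • ⁅Y1, Y2⁆)) =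
      expAll ((x ^ 3 * y ^ 2) • (3 : ℝ)⁻¹ • ⁅Y1, Y2⁆) := by
    rw [← expAll_add_of_lie_eq_zero (by simp)]
    congr 1
    module
  rw [h1, expAll_add_of_lie_lie_eq_zero, hb, expAll_chain h13 h23 z1 z2 z3, ← hZ]
  · rw [mul_assoc _ _ (expAll (y • Y)), hc.eq, ← mul_assoc, mul_assoc _ _ (expAll (y • Y)), hY,
      mul_one, mul_assoc _ (expAll ((-(1 / 2) * (x * y) * (-(x ^ 2 * y) / 2)) • ⁅Y1, Y2⁆))]
    congr 1
    congr 1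
    · congr 2; module
    · congr 1; module
  · rw [hb]; simp [z1, z2, z3]
  · rw [hb]; simp [z0]

end NilpotentExp


/-! ### Root strings and structure constants for two simple roots. -/

section SimplePair

variable {L : Type*} [LieRing L] [LieAlgebra ℝ L] [FiniteDimensional ℝ L] [IsKilling ℝ L]
  {H : LieSubalgebra ℝ L} [H.IsCartanSubalgebra] [LieModule.IsTriangularizable ℝ H L]

theorem IsRootComb.reflect {m n : ℤ} {α β : H.root} (h : IsRootComb m n α β) :
    IsRootComb (-m - n * (rootSystem H).pairingIn ℤ β α) n α β := by
  obtain ⟨γ, hγ⟩ := h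
  have h1 : ∀ x, γ.1 x = m * α.1 x + n * β.1 x := fun x => by
    simpa [root_apply] using LinearMap.congr_fun hγ x
  refine ⟨reflRoot α γ, ?_⟩
  ext x
  have h2 := root_apply (reflRoot α γ) x
  rw [h2, reflRoot_apply, h1, h1, ChevalleySystem.root_apply_coroot_self, ← pairingIn_cast]
  simp
  ring

open Classical in
theorem sum_single_smul_root {b : (rootSystem H).Base} {α β : H.root} (hα : α ∈ b.support)
    (hβ : β ∈ b.support) (m n : ℤ) :
    ∑ j ∈ b.support, (Pi.single α m + Pi.single β n : H.root → ℤ) j • (rootSystem H).root j =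
      m • (rootSystem H).root α + n • (rootSystem H).root β := by
  simp [add_smul, Finset.sum_add_distrib, Pi.single_apply, ite_smul, hα, hβ]

theorem IsRootComb.nonneg_or_nonpos {b : (rootSystem H).Base} {α β : H.root} (hα : α ∈ b.support)
    (hβ : β ∈ b.support) (hne : α ≠ β) {m n : ℤ} (h : IsRootComb m n α β) :
    (0 ≤ m ∧ 0 ≤ n) ∨ (m ≤ 0 ∧ n ≤ 0) := by
  classical
  have := b.pos_or_neg_of_sum_smul_root_mem (Pi.single α m + Pi.single β n)
    (by rw [sum_single_smul_root hα hβ]; exact h) (by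
      intro j hj
      by_contra hj'
      have h1 : j ≠ α := fun h => hj' (h ▸ hα)
      have h2 : j ≠ β := fun h => hj' (h ▸ hβ)
      simp [h1, h2] at hj)
  rcases this with h0 | h0
  · left
    have h1 := h0.le α
    have h2 := h0.le β
    simp [hne, hne.symm] at h1 h2
    exact ⟨h1, h2⟩
  · right
    have h1 := h0.le α
    have h2 := h0.le β
    simp [hne, hne.symm] at h1 h2
    exact ⟨h1, h2⟩

variable {b : (rootSystem H).Base} {α β : H.root}

theorem linearIndependent_simple (hα : α ∈ b.support) (hβ : β ∈ b.support) (hne : α ≠ β) :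
    LinearIndependent ℝ ![(rootSystem H).root α, (rootSystem H).root β] :=
  b.linearIndependent_pair_of_ne (i := ⟨α, hα⟩) (j := ⟨β, hβ⟩) (by simpa using hne)

theorem chainBotCoeff_simple (hα : α ∈ b.support) (hβ : β ∈ b.support) :
    (rootSystem H).chainBotCoeff α β = 0 :=
  RootPairing.Base.chainBotCoeff_eq_zero (b := b) (i := ⟨α, hα⟩) (j := ⟨β, hβ⟩)

theorem chainTopCoeff_simple (hα : α ∈ b.support) (hβ : β ∈ b.support) (hne : α ≠ β) :
    ((rootSystem H).chainTopCoeff α β : ℤ) = -(rootSystem H).pairingIn ℤ β α :=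
  RootPairing.Base.chainTopCoeff_eq_of_ne (b := b) (i := ⟨α, hα⟩) (j := ⟨β, hβ⟩)
    (by simpa using hne)

theorem isRootComb_simple_iff (hα : α ∈ b.support) (hβ : β ∈ b.support) (hne : α ≠ β) (k : ℕ) :
    IsRootComb k 1 α β ↔ k ≤ (rootSystem H).chainTopCoeff α β := by
  rw [isRootComb_one_iff (linearIndependent_simple hα hβ hne), chainBotCoeff_simple hα hβ]
  simp

/-- Reflecting `3α + 2β` in `α` gives `(2q - 3)α + 2β`, with `q` the top coefficient. Coefficients
over a base have one sign, so `2q ≥ 3`. -/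
theorem two_le_chainTopCoeff_of_isRootComb (hα : α ∈ b.support) (hβ : β ∈ b.support)
    (hne : α ≠ β) (h : IsRootComb 3 2 α β) : 2 ≤ (rootSystem H).chainTopCoeff α β := by
  have h1 := h.reflect.nonneg_or_nonpos hα hβ hne
  have h2 := chainTopCoeff_simple hα hβ hne
  omega

theorem chainTopCoeff_simple_bounds (hα : α ∈ b.support) (hβ : β ∈ b.support) (hne : α ≠ β) :
    (rootSystem H).chainTopCoeff α β ≤ 3 ∧ (rootSystem H).chainTopCoeff β α ≤ 3 ∧
      ((rootSystem H).chainTopCoeff α β ≤ 1 ∨ (rootSystem H).chainTopCoeff β α ≤ 1) := by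
  have h1 := chainTopCoeff_simple hα hβ hne
  have h2 := chainTopCoeff_simple hβ hα hne.symm
  have h3 := (rootSystem H).pairingIn_pairingIn_mem_set_of_isCrystal_of_isRed' α β
    ((rootSystem H).root.injective.ne hne) fun h => by
    have := LinearIndependent.pair_iff.1 (linearIndependent_simple hα hβ hne) 1 1
      (by rw [h]; module)
    simp at this
  simp only [Set.mem_insert_iff, Set.mem_singleton_iff, Prod.mk_zero_zero, Prod.mk_eq_zero,
      Prod.mk_one_one, Prod.mk_eq_one, Prod.mk.injEq] at h3
  omega

theorem linearIndependent_of_root_eq_add {δ : H.root}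
    (hli : LinearIndependent ℝ ![(rootSystem H).root α, (rootSystem H).root β])
    (hδ : (rootSystem H).root δ = (rootSystem H).root α + (rootSystem H).root β) :
    LinearIndependent ℝ ![(rootSystem H).root δ, (rootSystem H).root β] := by
  rw [LinearIndependent.pair_iff] at hli ⊢
  intro s t h
  obtain ⟨h1, h2⟩ := hli s (s + t) (by rw [← h, hδ]; module)
  exact ⟨h1, by linarith⟩

namespace ChevalleySystem

variable (E : ChevalleySystem H)

/-- The string is just `β, α + β`, so `α + β = w_α β`. The bracket is then `-w_α⁻¹ e_β`, which is
`±e_{α+β}`. -/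
theorem e_combRoot_eq_smul_lie
    (hli : LinearIndependent ℝ ![(rootSystem H).root α, (rootSystem H).root β])
    (hbot : (rootSystem H).chainBotCoeff α β = 0) (htop : (rootSystem H).chainTopCoeff α β = 1) :
    ∃ ε : ℝ, ε ^ 2 = 1 ∧ E.e (combRoot 1 1 α β) = ε • ⁅E.e α, E.e β⁆ := by
  have hp : (rootSystem H).pairingIn ℤ β α = -1 := by
    have := RootPairing.chainBotCoeff_sub_chainTopCoeff hli
    rw [hbot, htop] at this
    rw [← this]; norm_num
  have h1 : combRoot 1 1 α β = reflRoot α β := combRoot_eq (by rw [root_reflRoot, hp]; module)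
  have hf : ⁅E.e (negRoot α), E.e β⁆ = 0 := by
    refine eq_zero_of_not_isRootComb hli (a := -1) (b := 1) (Or.inr one_ne_zero) ?_
      (χ := fun x => (negRoot α).1 x + β.1 x) (fun x => ?_) (E.lie_e_mem (E.e_mem β) fun _ => rfl)
    · rw [isRootComb_one_iff hli, hbot]; omega
    · have : (negRoot α).1 x = -α.1 x := rfl
      rw [this]; push_cast; ring
  have hh : ⁅(coroot α.1 : L), E.e β⁆ = -((1 : ℕ) : ℝ) • E.e β := by
    rw [E.lie_coe_e, ← pairingIn_cast, hp]; norm_num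
  have he : ((ad ℝ L (E.e α)) ^ (1 + 1)) (E.e β) = 0 := by
    refine E.ad_pow_e_eq_zero hli ?_
    rw [isRootComb_one_iff hli, htop]; norm_num
  have h2 := E.ad_pow_eq_Ad_w_inv α 1 (E.e_ne_zero β) hf hh he
  obtain ⟨c, hc⟩ := E.exists_Ad_w_inv α β
  have hc2 := E.sq_eq_one_of_Ad_w_inv hc
  refine ⟨-c, by rw [neg_sq, hc2], ?_⟩
  rw [hc] at h2
  simp only [pow_one, LieAlgebra.ad_apply, Nat.factorial_one, Nat.cast_one, mul_one] at h2
  rw [h2, h1, smul_smul, smul_smul, show -c * -1 * c = c ^ 2 by ring, hc2, one_smul]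

/-- `D` enters twice, so its unknown sign `ε` disappears. -/
theorem M_two_smul_e {γ δ : H.root} {D : L} {ε : ℝ} (hε : ε ^ 2 = 1) (hD : E.e δ = ε • D)
    (hli : LinearIndependent ℝ ![(rootSystem H).root δ, (rootSystem H).root γ])
    (h : IsRootComb 2 1 δ γ) :
    E.M δ γ 2 • E.e (combRoot 2 1 δ γ) = (2 : ℝ)⁻¹ • ⁅D, ⁅D, E.e γ⁆⁆ := by
  have := E.ad_pow_e_eq_M hli (k := 2) h
  rw [Nat.cast_ofNat] at this
  rw [← this, pow_two, Module.End.mul_apply, LieAlgebra.ad_apply, LieAlgebra.ad_apply, hD,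
    smul_lie, smul_lie, lie_smul, smul_smul ε, ← pow_two, hε, one_smul]
  norm_num

open Classical in
/-- The vector `V` for which `exp (x^a y^b V)` is the factor of `x^a y^b` in the commutator
relation of `χ_α(x)` and `χ_β(y)`. -/
def commVec (a b : ℕ) (α β : H.root) : L :=
  if IsRootComb a b α β then E.C a b α β • E.e (combRoot a b α β) else 0

open Classical in
/-- The factor of `x^a y^b` in the commutator relation of `χ_α(x)` and `χ_β(y)`. -/
def commFactor (a b : ℕ) (α β : H.root) (x y : ℝ) : E.G :=
  if IsRootComb a b α β then E.χ (combRoot a b α β) (E.C a b α β * x ^ a * y ^ b) else 1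

theorem coe_commFactor (a b : ℕ) (α β : H.root) (x y : ℝ) :
    (E.commFactor a b α β x y : AllGL L) = expAll ((x ^ a * y ^ b) • E.commVec a b α β) := by
  unfold commFactor commVec
  split_ifs with h
  · rw [smul_smul]
    change expAll _ = _
    congr 2; ring
  · rw [smul_zero, expAll_zero]; rfl

theorem commVec_of_not {a b : ℕ} (h : ¬ IsRootComb a b α β) : E.commVec a b α β = 0 := if_neg h

theorem commVec_one_left
    (hli : LinearIndependent ℝ ![(rootSystem H).root β, (rootSystem H).root α]) (k : ℕ) :
    E.commVec 1 k α β = ((-1) ^ k * (k.factorial : ℝ)⁻¹) • ((ad ℝ L (E.e β)) ^ k) (E.e α) := by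
  unfold commVec
  rw [isRootComb_comm, Nat.cast_one]
  split_ifs with h
  · rw [combRoot_comm _ _ (isRootComb_comm.1 h), mul_smul, E.ad_pow_e_eq_M hli h, C, if_pos rfl,
      mul_smul]
  · rw [E.ad_pow_e_eq_zero hli h, smul_zero]

theorem commVec_one_right
    (hli : LinearIndependent ℝ ![(rootSystem H).root α, (rootSystem H).root β]) {k : ℕ}
    (hk : k ≠ 1) : E.commVec k 1 α β =
      ((-1) ^ (k + 1) * (k.factorial : ℝ)⁻¹) • ((ad ℝ L (E.e α)) ^ k) (E.e β) := by
  unfold commVec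
  rw [Nat.cast_one]
  split_ifs with h
  · rw [mul_smul, E.ad_pow_e_eq_M hli h, C, if_neg hk, if_pos rfl, mul_smul]
  · rw [E.ad_pow_e_eq_zero hli h, smul_zero]

theorem lie_ad_pow_mem (α β : H.root) (k l : ℕ) {χ : H → ℝ}
    (hχ : ∀ x, χ x = ((k + l : ℕ) : ℤ) * α.1 x + (2 : ℤ) * β.1 x) :
    ⁅((ad ℝ L (E.e α)) ^ k) (E.e β), ((ad ℝ L (E.e α)) ^ l) (E.e β)⁆ ∈ rootSpace H χ := by
  have h := lie_mem_genWeightSpace_of_mem_genWeightSpace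
    (E.ad_pow_e_mem α β k (χ := fun x => k * α.1 x + β.1 x) fun _ => rfl)
    (E.ad_pow_e_mem α β l (χ := fun x => l * α.1 x + β.1 x) fun _ => rfl)
  convert h using 2
  ext x
  rw [hχ]
  simp only [Pi.add_apply]
  push_cast; ring

/-- If `3α + 2β = 2(α + β) + α` is a root, then `M_two_smul_e` with `D = ⁅e_β, e_α⁆` contributes
`1/2`, and `2/3 · 1/2 = 1/3`. Otherwise the bracket vanishes by its weight. `commVec_two_three` is
analogous, with `1/3 · 1/2 = 1/6`. -/
theorem commVec_three_two (hα : α ∈ b.support) (hβ : β ∈ b.support) (hne : α ≠ β)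
    (htop : (rootSystem H).chainTopCoeff β α ≤ 1) : E.commVec 3 2 α β =
      (3 : ℝ)⁻¹ • ⁅⁅E.e α, E.e β⁆, ⁅E.e α, ⁅E.e α, E.e β⁆⁆⁆ := by
  have hli := linearIndependent_simple hα hβ hne
  have hli' := linearIndependent_simple hβ hα hne.symm
  unfold commVec
  split_ifs with h
  · have h2 := two_le_chainTopCoeff_of_isRootComb hα hβ hne h
    have h1 : IsRootComb 1 1 α β := by
      have := (isRootComb_simple_iff hα hβ hne 1).2 (by omega)
      simpa using this
    have h1' := isRootComb_comm.1 h1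
    have htop' : (rootSystem H).chainTopCoeff β α = 1 := by
      have := (isRootComb_simple_iff hβ hα hne.symm 1).1 (by simpa using h1')
      omega
    obtain ⟨ε, hε, hD⟩ := E.e_combRoot_eq_smul_lie hli' (chainBotCoeff_simple hβ hα) htop'
    rw [← combRoot_comm 1 1 h1] at hD
    have hδ := combRoot_spec h1
    rw [one_smul, one_smul] at hδ
    have h3 := combRoot_spec h
    have h3' : (rootSystem H).root (combRoot (3 : ℕ) (2 : ℕ) α β) =
        (2 : ℤ) • (rootSystem H).root (combRoot 1 1 α β) + (1 : ℤ) • (rootSystem H).root α := by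
      rw [h3, hδ]; push_cast; module
    have h4 := E.M_two_smul_e hε hD
      (linearIndependent_of_root_eq_add hli' (by rw [hδ, add_comm])) ⟨_, h3'⟩
    rw [combRoot_eq h3'] at h4
    have hC : E.C 3 2 α β = -(2 / 3) * E.M (combRoot 1 1 α β) α 2 := by simp [C]
    rw [hC, mul_smul, h4, ← lie_skew (E.e β) (E.e α), neg_lie, neg_lie, lie_neg, neg_neg,
      ← lie_skew ⁅E.e α, E.e β⁆ (E.e α), lie_neg, smul_smul, smul_neg, ← neg_smul]
    norm_num
  · have := eq_zero_of_not_isRootComb hli (a := 3) (b := 2) (Or.inr two_ne_zero) h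
      (fun _ => rfl) (E.lie_ad_pow_mem α β 1 2 fun x => by norm_num)
    simp only [pow_two, pow_one, Module.End.mul_apply, LieAlgebra.ad_apply] at this
    rw [this, smul_zero]

theorem commVec_two_three (hα : α ∈ b.support) (hβ : β ∈ b.support) (hne : α ≠ β)
    (htop : (rootSystem H).chainTopCoeff α β ≤ 1) : E.commVec 2 3 α β =
      (6 : ℝ)⁻¹ • ⁅⁅E.e β, E.e α⁆, ⁅E.e β, ⁅E.e β, E.e α⁆⁆⁆ := by
  have hli := linearIndependent_simple hα hβ hne
  have hli' := linearIndependent_simple hβ hα hne.symm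
  unfold commVec
  split_ifs with h
  · have h2 := two_le_chainTopCoeff_of_isRootComb hβ hα hne.symm (isRootComb_comm.1 h)
    have h1 : IsRootComb 1 1 α β := isRootComb_comm.1 (by
      have := (isRootComb_simple_iff hβ hα hne.symm 1).2 (by omega)
      simpa using this)
    have htop' : (rootSystem H).chainTopCoeff α β = 1 := by
      have := (isRootComb_simple_iff hα hβ hne 1).1 (by simpa using h1)
      omega
    obtain ⟨ε, hε, hD⟩ := E.e_combRoot_eq_smul_lie hli (chainBotCoeff_simple hα hβ) htop'
    have hδ := combRoot_spec h1
    rw [one_smul, one_smul] at hδ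
    have h3 := combRoot_spec h
    have h3' : (rootSystem H).root (combRoot (2 : ℕ) (3 : ℕ) α β) =
        (2 : ℤ) • (rootSystem H).root (combRoot 1 1 α β) + (1 : ℤ) • (rootSystem H).root β := by
      rw [h3, hδ]; push_cast; module
    have h4 := E.M_two_smul_e hε hD (linearIndependent_of_root_eq_add hli hδ) ⟨_, h3'⟩
    rw [combRoot_eq h3'] at h4
    have hC : E.C 2 3 α β = -(1 / 3) * E.M (combRoot 1 1 α β) β 2 := by simp [C]
    rw [hC, mul_smul, h4, ← lie_skew (E.e α) (E.e β), neg_lie, neg_lie, lie_neg, neg_neg,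
      ← lie_skew ⁅E.e β, E.e α⁆ (E.e β), lie_neg, smul_smul, smul_neg, ← neg_smul]
    norm_num
  · have := eq_zero_of_not_isRootComb hli' (a := 3) (b := 2) (Or.inr two_ne_zero)
      (fun h' => h (isRootComb_comm.1 h')) (fun _ => rfl)
      (E.lie_ad_pow_mem β α 1 2 fun x => by norm_num)
    simp only [pow_two, pow_one, Module.End.mul_apply, LieAlgebra.ad_apply] at this
    rw [this, smul_zero]

end ChevalleySystem

end SimplePair


/-! ### The commutator relation for two distinct simple roots. -/

section Commutator

variable {L : Type*} [LieRing L] [LieAlgebra ℝ L] [FiniteDimensional ℝ L] [IsKilling ℝ L]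
  {H : LieSubalgebra ℝ L} [H.IsCartanSubalgebra] [LieModule.IsTriangularizable ℝ H L]
  {b : (rootSystem H).Base} {α β : H.root}

namespace ChevalleySystem

variable (E : ChevalleySystem H)

theorem coe_conj_χ (g : E.G) (α : H.root) (x : ℝ) :
    ((g * E.χ α x * g⁻¹ : E.G) : AllGL L) = expAll (x • E.Ad g (E.e α)) := by
  rw [← map_smul, ← E.conj_expAll]; rfl

theorem lie_simple_chain (hα : α ∈ b.support) (hβ : β ∈ b.support) (hne : α ≠ β)
    (htop : (rootSystem H).chainTopCoeff α β ≤ 3) (htop' : (rootSystem H).chainTopCoeff β α ≤ 1) :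
    ⁅E.e α, ⁅E.e α, ⁅E.e α, ⁅E.e α, E.e β⁆⁆⁆⁆ = 0 ∧ ⁅E.e β, ⁅E.e α, E.e β⁆⁆ = 0 := by
  have hli := linearIndependent_simple hα hβ hne
  have hli' := linearIndependent_simple hβ hα hne.symm
  have h1 : ((ad ℝ L (E.e α)) ^ 4) (E.e β) = 0 := E.ad_pow_e_eq_zero hli (by
    rw [isRootComb_simple_iff hα hβ hne]; omega)
  have h2 : ((ad ℝ L (E.e β)) ^ 2) (E.e α) = 0 := E.ad_pow_e_eq_zero hli' (by
    rw [isRootComb_simple_iff hβ hα hne.symm]; omega)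
  simp only [pow_succ, pow_zero, one_mul, Module.End.mul_apply, LieAlgebra.ad_apply] at h1 h2
  refine ⟨h1, ?_⟩
  rw [← lie_skew (E.e α), lie_neg, h2, neg_zero]

theorem Ad_χ_e_of_lie_eq_zero (α β : H.root) (x : ℝ)
    (h : ⁅E.e α, ⁅E.e α, ⁅E.e α, ⁅E.e α, E.e β⁆⁆⁆⁆ = 0) :
    E.Ad (E.χ α x) (E.e β) = E.e β + x • ⁅E.e α, E.e β⁆ + (2⁻¹ * x ^ 2) • ⁅E.e α, ⁅E.e α, E.e β⁆⁆ +
      (6⁻¹ * x ^ 3) • ⁅E.e α, ⁅E.e α, ⁅E.e α, E.e β⁆⁆⁆ := by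
  rw [E.Ad_χ α x (E.e β) 4 (by
    simpa only [pow_succ, pow_zero, one_mul, Module.End.mul_apply, LieAlgebra.ad_apply] using h)]
  simp only [Finset.sum_range_succ, Finset.sum_range_zero, zero_add, pow_succ, pow_zero, one_mul,
    Module.End.mul_apply, LieAlgebra.ad_apply, Nat.factorial, Module.End.one_apply]
  norm_num

theorem commVec_succ_one_eq_zero (hα : α ∈ b.support) (hβ : β ∈ b.support) (hne : α ≠ β)
    (htop : (rootSystem H).chainTopCoeff α β ≤ 1) {k : ℕ} (hk : 2 ≤ k) :
    E.commVec k 1 α β = 0 :=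
  E.commVec_of_not fun h => by
    have := (isRootComb_simple_iff hα hβ hne k).1 h
    omega

theorem commVec_one_succ_eq_zero (hα : α ∈ b.support) (hβ : β ∈ b.support) (hne : α ≠ β)
    (htop : (rootSystem H).chainTopCoeff β α ≤ 1) {k : ℕ} (hk : 2 ≤ k) :
    E.commVec 1 k α β = 0 :=
  E.commVec_of_not fun h => by
    have := (isRootComb_simple_iff hβ hα hne.symm k).1 (isRootComb_comm.1 h)
    omega

/-- The commutator relation for two distinct simple roots. -/
theorem χ_inv_mul_χ_mul_χ (hα : α ∈ b.support) (hβ : β ∈ b.support) (hne : α ≠ β) (x y : ℝ) :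
    (E.χ β y)⁻¹ * E.χ α x * E.χ β y = E.χ α x *
      (([(1, 1), (1, 2), (2, 1), (1, 3), (3, 1), (2, 3), (3, 2)] : List (ℕ × ℕ)).map fun ab =>
        E.commFactor ab.1 ab.2 α β x y).prod := by
  have hli := linearIndependent_simple hα hβ hne
  have hli' := linearIndependent_simple hβ hα hne.symm
  obtain ⟨hb, hb', hor⟩ := chainTopCoeff_simple_bounds hα hβ hne
  apply Subtype.ext
  simp only [List.map_cons, List.map_nil, List.prod_cons, List.prod_nil, mul_one,
    Subgroup.coe_mul, coe_commFactor]
  -- At most one of the two strings has more than two roots. If it is the `β`-string through `α`,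
  -- the conjugate of `χ_α(x)` is expanded directly. Otherwise `χ_α(x)` is pulled out and the
  -- conjugate of `χ_β(-y)` by `χ_α(-x)` is expanded. In each case the factors belonging to the
  -- other string are trivial.
  rcases hor with h | h
  · obtain ⟨h4, h01⟩ := E.lie_simple_chain hβ hα hne.symm hb' h
    obtain ⟨h02, h03, h13, h23, z0, z1, z2, z3⟩ := lie_chain rfl rfl rfl h4 h01
    have hL := E.coe_conj_χ (E.χ β (-y)) α x
    rw [E.Ad_χ_e_of_lie_eq_zero β α (-y) h4,
      expAll_commutator_left h01 h02 h03 h13 h23 z0 z1 z2 z3, χ_neg, inv_inv] at hL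
    simp only [Subgroup.coe_mul] at hL
    rw [hL, E.commVec_one_left hli', E.commVec_one_left hli', E.commVec_one_left hli',
      E.commVec_succ_one_eq_zero hα hβ hne h le_rfl,
      E.commVec_succ_one_eq_zero hα hβ hne h (by norm_num),
      E.commVec_two_three hα hβ hne h,
      E.commVec_of_not fun h' => by
        have := two_le_chainTopCoeff_of_isRootComb hα hβ hne h'
        omega]
    simp only [smul_zero, expAll_zero, mul_one, one_mul, pow_succ, pow_zero, Module.End.mul_apply,
      LieAlgebra.ad_apply, Nat.factorial, mul_assoc]
    norm_num
    rfl
  · obtain ⟨h4, h01⟩ := E.lie_simple_chain hα hβ hne hb h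
    obtain ⟨h02, h03, h13, h23, z0, z1, z2, z3⟩ := lie_chain rfl rfl rfl h4 h01
    have hL := E.coe_conj_χ (E.χ α (-x)) β (-y)
    have hR := expAll_commutator_right h01 h02 h03 h13 h23 z0 z1 z2 z3 x y
    rw [E.Ad_χ_e_of_lie_eq_zero α β (-x) h4] at hL
    rw [← hL] at hR
    have hZ : ((E.χ β y)⁻¹ * E.χ α x * E.χ β y : E.G) = E.χ α x *
        (E.χ α (-x) * E.χ β (-y) * (E.χ α (-x))⁻¹ * E.χ β y) := by
      rw [E.χ_neg α x, E.χ_neg β y]; group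
    have hZ' := congrArg Subtype.val hZ
    simp only [Subgroup.coe_mul] at hZ'
    rw [hZ']
    have hχ : expAll (y • E.e β) = (E.χ β y : AllGL L) := rfl
    rw [hχ] at hR
    simp only [Subgroup.coe_mul] at hR
    rw [hR, E.commVec_one_left hli', E.commVec_one_right hli (by norm_num),
      E.commVec_one_right hli (by norm_num),
      E.commVec_one_succ_eq_zero hα hβ hne h le_rfl,
      E.commVec_one_succ_eq_zero hα hβ hne h (by norm_num),
      E.commVec_three_two hα hβ hne h,
      E.commVec_of_not (a := 2) (b := 3) fun h' => by
        have := two_le_chainTopCoeff_of_isRootComb hβ hα hne.symm (isRootComb_comm.1 h')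
        omega]
    simp only [smul_zero, expAll_zero, mul_one, one_mul, pow_succ, pow_zero, Module.End.mul_apply,
      LieAlgebra.ad_apply, Nat.factorial, mul_assoc]
    rw [← lie_skew (E.e α) (E.e β)]
    norm_num

end ChevalleySystem

end Commutator


/-! ### The action of a simple reflection on the Iwasawa decomposition -/

theorem eq_filter_append_cons_filter {ι : Type*} [LinearOrder ι] {l : List ι}
    (hl : l.Pairwise (· < ·)) {p : ι} (hp : p ∈ l) :
    l = l.filter (fun r => r < p) ++ p :: l.filter (fun r => p < r) := by
  induction l with
  | nil => simp at hp
  | cons a l ih =>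
    obtain ⟨ha, hl⟩ := List.pairwise_cons.1 hl
    rcases List.mem_cons.1 hp with rfl | hp
    · have h1 : l.filter (fun r => r < p) = [] :=
        List.filter_eq_nil_iff.2 fun r hr => by simpa using (ha r hr).le
      have h2 : l.filter (fun r => p < r) = l :=
        List.filter_eq_self.2 fun r hr => by simpa using ha r hr
      simp [h1, h2]
    · have h1 := ha p hp
      simp only [List.filter_cons, h1, not_lt_of_gt h1, decide_true, decide_false, if_true]
      rw [List.cons_append]
      congr 1
      simpa using ih hl hp

theorem prod_ofFn_eq_mul_mul {G : Type*} [Monoid G] {N : ℕ} (f : Fin N → G) (p : Fin N) :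
    (List.ofFn f).prod = (((List.finRange N).filter (fun r => r < p)).map f).prod * f p *
      (((List.finRange N).filter (fun r => p < r)).map f).prod := by
  have h := eq_filter_append_cons_filter (l := List.finRange N)
    (List.sortedLT_finRange N).pairwise (List.mem_finRange p)
  rw [List.ofFn_eq_map]
  conv_lhs => rw [h]
  rw [List.map_append, List.prod_append, List.map_cons, List.prod_cons, mul_assoc]

theorem inv_mul_list_prod_mul {G ι : Type*} [Group G] (g : G) (l : List ι) (f : ι → G) :
    g⁻¹ * (l.map f).prod * g = (l.map fun j => g⁻¹ * f j * g).prod := by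
  induction l with
  | nil => simp
  | cons a l ih => rw [List.map_cons, List.prod_cons, List.map_cons, List.prod_cons, ← ih]; group

section Action

variable {L : Type*} [LieRing L] [LieAlgebra ℝ L] [FiniteDimensional ℝ L] [IsKilling ℝ L]
  {H : LieSubalgebra ℝ L} [H.IsCartanSubalgebra] [LieModule.IsTriangularizable ℝ H L]
  {b : (rootSystem H).Base}

theorem isPos_of_root_eq_add {α β γ : H.root} (hα : α ∈ b.support) (hβ : β ∈ b.support) {m n : ℕ}
    (hmn : 0 < m + n)
    (h : (rootSystem H).root γ =
      (m : ℤ) • (rootSystem H).root α + (n : ℤ) • (rootSystem H).root β) : b.IsPos γ := by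
  classical
  rw [← sum_single_smul_root hα hβ] at h
  rw [RootPairing.Base.isPos_iff, b.height_eq_sum h]
  simp [Finset.sum_add_distrib, hα, hβ]
  omega

namespace PositiveRootOrdering

variable (ord : PositiveRootOrdering b)

theorem isPos_root (r : Fin ord.N) : b.IsPos (ord.root r) := (ord.isPos_iff _).2 ⟨r, rfl⟩

theorem root_mem_support {r : Fin ord.N} {i : Fin ord.n} (h : r < ord.pos i) :
    ord.root r ∈ b.support :=
  (ord.mem_support_iff r).2 (lt_trans (Fin.lt_def.1 h) i.2)

theorem root_ne_simple {r : Fin ord.N} {i : Fin ord.n} (h : r ≠ ord.pos i) :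
    ord.root r ≠ ord.simple i := fun h' => h (ord.root_injective h')

theorem isPos_reflRoot {γ : H.root} (hγ : b.IsPos γ) {i : Fin ord.n} (h : γ ≠ ord.simple i) :
    b.IsPos (reflRoot (ord.simple i) γ) :=
  hγ.reflectionPerm (ord.simple i).2 h

end PositiveRootOrdering

namespace ChevalleySystem

variable (E : ChevalleySystem H)

theorem w_inv_conj_commFactors (α β : H.root) (x y : ℝ) :
    (E.w β)⁻¹ * (([(1, 1), (1, 2), (2, 1), (1, 3), (3, 1), (2, 3), (3, 2)] : List (ℕ × ℕ)).map
      fun ab => E.commFactor ab.1 ab.2 α β x y).prod * E.w β = E.χtilde α β x y := by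
  classical
  rw [inv_mul_list_prod_mul, χtilde]
  congr 2
  funext ab
  rw [commFactor]
  split_ifs with h
  · rw [w_inv_conj_χ]
    congr 1
    ring
  · group

variable (ord : PositiveRootOrdering b)

/-- Factors before position `i` are conjugated by `χ_i(x_i) w_i`, later ones by `w_i` alone. This is
why only the former acquire a commutator term. -/
theorem uProd_mul_w (i : Fin ord.n) (x : Fin ord.N → ℝ) :
    E.uProd ord x * E.w (ord.simple i) =
      E.χ (ord.simple i) (x (ord.pos i)) * E.w (ord.simple i) *
        (((List.finRange ord.N).filter (fun r => r < ord.pos i)).map fun r =>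
          E.χ (reflRoot (ord.simple i) (ord.root r)) (E.eta (ord.simple i) (ord.root r) * x r) *
            E.χtilde (ord.root r) (ord.simple i) (x r) (x (ord.pos i))).prod *
        (((List.finRange ord.N).filter (fun r => ord.pos i < r)).map fun r =>
          E.χ (reflRoot (ord.simple i) (ord.root r))
            (E.eta (ord.simple i) (ord.root r) * x r)).prod := by
  set β : H.root := (ord.simple i).1 with hβ
  set y := x (ord.pos i) with hy
  have hA : (((List.finRange ord.N).filter (fun r => r < ord.pos i)).map fun r =>
      E.χ (reflRoot β (ord.root r)) (E.eta β (ord.root r) * x r) *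
        E.χtilde (ord.root r) β (x r) y).prod =
      (E.χ β y * E.w β)⁻¹ * (((List.finRange ord.N).filter (fun r => r < ord.pos i)).map fun r =>
        E.χ (ord.root r) (x r)).prod * (E.χ β y * E.w β) := by
    rw [inv_mul_list_prod_mul]
    congr 1
    refine List.map_congr_left fun r hr => ?_
    -- Positions before `pos i` carry simple roots, as the commutator relation requires.
    have hr' : r < ord.pos i := by simpa using (List.mem_filter.1 hr).2
    rw [← w_inv_conj_χ, ← w_inv_conj_commFactors, show (E.χ β y * E.w β)⁻¹ *
      E.χ (ord.root r) (x r) * (E.χ β y * E.w β) =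
      (E.w β)⁻¹ * ((E.χ β y)⁻¹ * E.χ (ord.root r) (x r) * E.χ β y) * E.w β by group,
      E.χ_inv_mul_χ_mul_χ (ord.root_mem_support hr') (ord.simple i).2
        (ord.root_ne_simple hr'.ne), ← hβ]
    group
  have hB : (((List.finRange ord.N).filter (fun r => ord.pos i < r)).map fun r =>
      E.χ (reflRoot β (ord.root r)) (E.eta β (ord.root r) * x r)).prod =
      (E.w β)⁻¹ * (((List.finRange ord.N).filter (fun r => ord.pos i < r)).map fun r =>
        E.χ (ord.root r) (x r)).prod * E.w β := by
    rw [inv_mul_list_prod_mul]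
    congr 2
    funext r
    rw [w_inv_conj_χ]
  have hU : E.uProd ord x = _ := prod_ofFn_eq_mul_mul (fun r => E.χ (ord.root r) (x r)) (ord.pos i)
  rw [hA, hB, hU]
  have : E.χ (ord.root (ord.pos i)) (x (ord.pos i)) = E.χ β y := rfl
  simp only [this]
  group

theorem hProd_mul_χ {t : Fin ord.n → ℝ} (ht : ∀ j, 0 < t j) (β : H.root) (x : ℝ) :
    E.hProd ord t * E.χ β x =
      E.χ β ((∏ j, t j ^ (-(rootSystem H).pairingIn ℤ β (ord.simple j))) * x) *
        E.hProd ord t := by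
  have key : ∀ l : List (Fin ord.n), (l.map fun j => E.h (ord.simple j) (t j)).prod * E.χ β x =
      E.χ β ((l.map fun j => t j ^ (-(rootSystem H).pairingIn ℤ β (ord.simple j))).prod * x) *
        (l.map fun j => E.h (ord.simple j) (t j)).prod := by
    intro l
    induction l with
    | nil => simp
    | cons j l ih =>
      rw [List.map_cons, List.prod_cons, mul_assoc, ih, ← mul_assoc, h_mul_χ _ _ _ (ht j).ne',
        mul_assoc, List.map_cons, List.prod_cons, mul_assoc (t j ^ _)]
  rw [hProd, List.ofFn_eq_map, key, Fin.prod_univ_def]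

theorem commute_h_hProd {t : Fin ord.n → ℝ} (ht : ∀ j, 0 < t j) (β : H.root) {s : ℝ}
    (hs : s ≠ 0) : Commute (E.h β s) (E.hProd ord t) := by
  refine Commute.list_prod_right _ _ fun g hg => ?_
  obtain ⟨j, rfl⟩ := (List.mem_ofFn' _ _).1 hg
  exact E.h_commute _ _ hs (ht j).ne'

/-- Conjugation by `h` turns `w_β` into `w_β(c) = w_β h_β(c)`, and `w_β w_β = h_β(-1)`. -/
theorem w_mul_hProd_mul_w {t : Fin ord.n → ℝ} (ht : ∀ j, 0 < t j) (β : H.root) {c : ℝ}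
    (hc : c = ∏ j, t j ^ (-(rootSystem H).pairingIn ℤ β (ord.simple j))) (hc0 : c ≠ 0) :
    E.w β * E.hProd ord t * E.w β = E.hProd ord t * E.h β (-c) := by
  have h1 : ∀ x, E.hProd ord t * E.χ β x = E.χ β (c * x) * E.hProd ord t := fun x => by
    rw [E.hProd_mul_χ ord ht, ← hc]
  have h2 : ∀ x, E.hProd ord t * E.χ (negRoot β) x =
      E.χ (negRoot β) (c⁻¹ * x) * E.hProd ord t := fun x => by
    rw [E.hProd_mul_χ ord ht, hc, ← Finset.prod_inv_distrib]
    congr 4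
    funext j
    rw [← zpow_neg]
    congr 2
    have := pairingIn_cast (ord.simple j) (negRoot β)
    have h' := pairingIn_cast (ord.simple j) β
    have hn : (negRoot β).1 (coroot (ord.simple j : H.root).1) =
      -β.1 (coroot (ord.simple j : H.root).1) := rfl
    rw [hn, ← h'] at this
    exact_mod_cast this
  have h3 : E.hProd ord t * E.w β = E.w β * E.h β c * E.hProd ord t := by
    rw [← wt_eq, w, wt, wt, ← mul_assoc, ← mul_assoc, h1, mul_assoc _ (E.hProd ord t), h2,
      ← mul_assoc, mul_assoc _ (E.hProd ord t), h1, ← mul_assoc]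
    simp
  rw [mul_assoc, h3, ← mul_assoc, ← mul_assoc, w_mul_w, h_mul_h _ _ (by norm_num) hc0, neg_one_mul,
    (E.commute_h_hProd ord ht β (neg_ne_zero.2 hc0)).eq]

theorem κ_mul_hProd_mul_χ_mul_w {t : Fin ord.n → ℝ} (ht : ∀ j, 0 < t j) (β : H.root) {c r y : ℝ}
    (hc : c = ∏ j, t j ^ (-(rootSystem H).pairingIn ℤ β (ord.simple j))) (hc0 : c ≠ 0)
    (hr : r = √((c * y) ^ 2 + 1)) (hr0 : r ≠ 0) :
    E.κ β (c * y) * E.hProd ord t * (E.χ β y * E.w β) =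
      E.h β (c / r) * E.hProd ord t * E.χ β (-(c / r) ^ 2 * y) := by
  have hcr : c / r ≠ 0 := div_ne_zero hc0 hr0
  have e1 : E.κ β (c * y) * E.hProd ord t * (E.χ β y * E.w β) =
      E.χ β (-(c * y)) * E.h β (-1 / r) * (E.w β * E.hProd ord t * E.w β) := by
    rw [κ, ← hr, ← mul_assoc, mul_assoc _ (E.hProd ord t), E.hProd_mul_χ ord ht, ← hc, E.χ_neg]
    group
  -- Moving `χ_β(z)` left past `h` and `h_β(c / r)` multiplies `z` by `c (c / r)⁻²`. The new
  -- parameter is the one that this sends to `-(c y)`.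
  have e2 : (((c / r) ^ 2)⁻¹ * (c * (-(c / r) ^ 2 * y))) = -(c * y) := by field_simp
  rw [e1, E.w_mul_hProd_mul_w ord ht β hc hc0, mul_assoc (E.h β (c / r)), E.hProd_mul_χ ord ht,
    ← hc, ← mul_assoc (E.h β (c / r)), h_mul_χ_self _ _ hcr, e2, mul_assoc, mul_assoc,
    ← (E.commute_h_hProd ord ht β (neg_ne_zero.2 hc0)).eq, ← mul_assoc (E.h β (-1 / r)),
    h_mul_h _ _ (div_ne_zero (by norm_num) hr0) (neg_ne_zero.2 hc0)]
  congr 3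
  ring

theorem χ_mem_U {γ : H.root} (hγ : b.IsPos γ) (x : ℝ) : E.χ γ x ∈ E.U b :=
  Subgroup.subset_closure ⟨γ, x, hγ, rfl⟩

theorem χtilde_mem_U {α : H.root} (hα : α ∈ b.support) {i : Fin ord.n} (hne : α ≠ ord.simple i)
    (x y : ℝ) : E.χtilde α (ord.simple i) x y ∈ E.U b := by
  classical
  refine Subgroup.list_prod_mem _ fun g hg => ?_
  obtain ⟨ab, hab, rfl⟩ := List.mem_map.1 hg
  have hpos : 0 < ab.1 := by
    simp only [List.mem_cons, List.not_mem_nil, or_false] at hab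
    rcases hab with rfl | rfl | rfl | rfl | rfl | rfl | rfl <;> norm_num
  split_ifs with h
  -- The root `aα + bα_i` is positive, and `a > 0` keeps it different from `α_i`, the only positive
  -- root that the reflection makes negative.
  · refine E.χ_mem_U (ord.isPos_reflRoot
      (isPos_of_root_eq_add hα (ord.simple i).2 (by omega) (combRoot_spec h)) fun h' => ?_) _
    have h1 := combRoot_spec h
    rw [h', natCast_zsmul, natCast_zsmul] at h1
    have h2 := LinearIndependent.pair_iff.1
      (linearIndependent_simple hα (ord.simple i).2 hne) ab.1 (ab.2 - 1) (by
        rw [sub_smul, one_smul, Nat.cast_smul_eq_nsmul, Nat.cast_smul_eq_nsmul, ← add_sub_assoc,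
          ← h1, sub_self])
    exact hpos.ne' (by exact_mod_cast h2.1)
  · exact one_mem _

theorem uNew_mem_U (i : Fin ord.n) (c r : ℝ) (x : Fin ord.N → ℝ) : E.uNew ord i c r x ∈ E.U b := by
  have key : ∀ s : Fin ord.N, s ≠ ord.pos i → ∀ z : ℝ,
      E.χ (reflRoot (ord.simple i) (ord.root s)) z ∈ E.U b := fun s hs z =>
    E.χ_mem_U (ord.isPos_reflRoot (ord.isPos_root s) (ord.root_ne_simple hs)) z
  refine mul_mem (mul_mem (E.χ_mem_U (ord.isPos_root (ord.pos i)) _) ?_) ?_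
  · refine Subgroup.list_prod_mem _ fun g hg => ?_
    obtain ⟨s, hs, rfl⟩ := List.mem_map.1 hg
    have hs' : s < ord.pos i := by simpa using (List.mem_filter.1 hs).2
    exact mul_mem (key s hs'.ne _)
      (E.χtilde_mem_U ord (ord.root_mem_support hs') (ord.root_ne_simple hs'.ne) _ _)
  · refine Subgroup.list_prod_mem _ fun g hg => ?_
    obtain ⟨s, hs, rfl⟩ := List.mem_map.1 hg
    have hs' : ord.pos i < s := by simpa using (List.mem_filter.1 hs).2
    exact key s hs'.ne' _

theorem h_mem_Hplus {α : H.root} (hα : α ∈ b.support) {t : ℝ} (ht : 0 < t) :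
    E.h α t ∈ E.Hplus b :=
  Subgroup.subset_closure ⟨α, t, hα, ht, rfl⟩

theorem hProd_mem_Hplus {t : Fin ord.n → ℝ} (ht : ∀ j, 0 < t j) : E.hProd ord t ∈ E.Hplus b := by
  refine Subgroup.list_prod_mem _ fun g hg => ?_
  obtain ⟨j, rfl⟩ := (List.mem_ofFn' _ _).1 hg
  exact E.h_mem_Hplus (ord.simple j).2 (ht j)

theorem coset_eq_of_mem_K {k g : E.G} (hk : k ∈ E.K) : E.coset g = E.coset (k * g) :=
  Quotient.sound (QuotientGroup.rightRel_apply.2 (by simpa using hk))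

end ChevalleySystem

end Action

end ChevalleyIwasawa

end

theorem mainTheorem1 {L : Type*} [LieRing L] [LieAlgebra ℝ L] [FiniteDimensional ℝ L]
    [LieAlgebra.IsKilling ℝ L] {H : LieSubalgebra ℝ L} [H.IsCartanSubalgebra]
    [LieModule.IsTriangularizable ℝ H L]
    (E : ChevalleyIwasawa.ChevalleySystem H)
    {b : (LieAlgebra.IsKilling.rootSystem H).Base}
    (ord : ChevalleyIwasawa.PositiveRootOrdering b)
    (t : Fin ord.n → ℝ) (ht : ∀ j, 0 < t j) (x : Fin ord.N → ℝ) (i : Fin ord.n)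
    (c r : ℝ) (hc : c = ∏ j, t j ^ (-ord.cartan i j))
    (hr : r = √((c * x (ord.pos i)) ^ 2 + 1)) :
    E.κ (ord.simple i) (c * x (ord.pos i)) ∈ E.K ∧
    E.κ (ord.simple i) (c * x (ord.pos i)) * (E.hProd ord t * E.uProd ord x) * E.w (ord.simple i) =
      (E.h (ord.simple i) (c / r) * E.hProd ord t) * E.uNew ord i c r x ∧
    E.h (ord.simple i) (c / r) * E.hProd ord t ∈ E.Hplus b ∧
    E.uNew ord i c r x ∈ E.U b ∧
    E.coset (E.hProd ord t * E.uProd ord x * E.w (ord.simple i)) =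
      E.coset ((E.h (ord.simple i) (c / r) * E.hProd ord t) * E.uNew ord i c r x) := by
  have hc0 : 0 < c := hc ▸ Finset.prod_pos fun j _ => zpow_pos (ht j) _
  have hr0 : 0 < r := hr ▸ Real.sqrt_pos.2 (by positivity)
  have hκ := E.κ_mem_K (ord.simple i) (c * x (ord.pos i))
  have hmain : E.κ (ord.simple i) (c * x (ord.pos i)) * (E.hProd ord t * E.uProd ord x) *
      E.w (ord.simple i) =
      (E.h (ord.simple i) (c / r) * E.hProd ord t) * E.uNew ord i c r x := by
    -- Once `u w_i` is reordered, `κ` meets only `h χ_i(x_i) w_i`. The remaining factors are carried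
    -- along unchanged.
    rw [mul_assoc, mul_assoc, E.uProd_mul_w, ← mul_assoc, ← mul_assoc, ← mul_assoc,
      E.κ_mul_hProd_mul_χ_mul_w ord ht _ hc hc0.ne' hr hr0.ne', ChevalleyIwasawa.ChevalleySystem.uNew]
    simp only [mul_assoc]
  refine ⟨hκ, hmain, mul_mem (E.h_mem_Hplus (ord.simple i).2 (div_pos hc0 hr0))
    (E.hProd_mem_Hplus ord ht), E.uNew_mem_U ord i c r x, ?_⟩
  rw [← hmain, E.coset_eq_of_mem_K hκ, ← mul_assoc]
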